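/- **Theorem (the space $T^\xi_{ess\text{-}inc}$ is reflexive).** Let $\mathbb N=\{1,2,\dots\}$. For finite $s,t\subset\mathbb N$ write $s<t$ if every element of $s$ is smaller than every element of $t$, and $k\le s$ if $k\le x$ for all $x\in s$; "$k\le s_1<\dots<s_k$" means $k\le s_i$ for all $i$ and $s_i<s_j$ for all $i<j$. *Schreier families.* Fix for each countable limit ordinal $\lambda$ a sequence $(\alpha(\lambda,j))_{j\in\mathbb N}$ in $[1,\lambda)$ strictly increasing to $\lambda$. Let $\mathcal S_0=\{\emptyset\}\cup\{\{n\}:n\in\mathbb N\}$; let $\mathcal S_{\alpha+1}$ be the set of all $\bigcup_{i=1}^kE_i$ with $E_i\in\mathcal S_\alpha$ and $k\le E_1<\dots<E_k$; and for limit $\lambda$ let $\mathcal S_\lambda$ be the set of all $E$ such that $E\in\mathcal S_{\alpha(\lambda,j)}$ and $j\le E$ for some $j$. *Choices.* Fix a countable ordinal $\xi$ and strictly increasing sequences $(m_j)_{j\ge0}$, $(n_j)_{j\ge0}$ of natural numbers with $m_0=2$, $m_1=4$, $m_j\ge m_{j-1}^2$ for $j\ge2$, and $n_0=1$, $n_1=6$,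 $n_j>\log_2 m_j^2+n_{j-1}$ for $j\ge2$. Let $\mathcal Q$ be the set of all finite sequences $((g_1,m_{j_1}),\dots,(g_k,m_{j_k}))$, $k\ge1$, with finitely supported $g_i:\mathbb N\to\{-1,0,1\}$, $j_i\in\mathbb N$ and $m_{j_1}<\dots<m_{j_k}$. Fix an injection $\sigma:\mathcal Q\to\{m_j:j\in\mathbb N\}$ such that $\sigma((g_1,m_{j_1}),\dots,(g_k,m_{j_k}))>m_{j_k}$ always. *Trees.* Let $\widetilde{\mathcal T}_\xi$ be the set of all finite sequences $((g_1,m_{j_1}),\dots,(g_k,m_{j_k}))$, $k\ge 1$, with nonzero $g_i:\mathbb N\to\{-1,0,1\}$ such that $\operatorname{supp}g_1<\dots<\operatorname{supp}g_k$, $\operatorname{supp}g_i\in\mathcal S_{n_{j_i}}$, $1=j_1<\dots<j_k$, $m_{j_i}=\sigma((g_1,m_{j_1}),\dots,(g_{i-1},m_{j_{i-1}}))$ for $2\le i\le k$, and $\{\min\operatorname{supp}g_i:i\le k\}\in\mathcal S_\xi$; order it by initial segments. Let $\mathcal T_\xi$ be the set of last entries $t=(g_t,m_{j_t})$ of these sequences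 $\tilde t$. Each last entry determines its sequence, so $\mathcal T_\xi$ inherits the order; the set $\mathcal W_\xi=\{m_{j_t}:t\in\mathcal T_\xi\}$ is ordered by: $m\le m'$ if there are $t\le t'$ in $\mathcal T_\xi$ with weights $m=m_{j_t}$ and $m'=m_{j_{t'}}$. A set $X\subset\mathcal T_\xi$ is *essentially incomparable* if for all $t_1,t_2\in X$ with $m_{j_{t_1}}<m_{j_{t_2}}$ in the order of $\mathcal W_\xi$, the unique $g$ with $(g,m_{j_{t_1}})\le t_2$ in $\mathcal T_\xi$ satisfies $\operatorname{supp}g<\operatorname{supp}g_{t_1}$. *The norm.* On $c_{00}(\mathbb N)$ let $G_0=\{\pm e_n^*:n\in\mathbb N\}$, $G_1=\{m_j^{-1}\sum_ng(n)e_n^*: j\in\mathbb N,\ g:\mathbb N\to\{-1,0,1\},\ \operatorname{supp}g\in\mathcal S_{n_j}\}$ and $G=G_0\cup G_1$. For $f=m_j^{-1}\sum_ng(n)e_n^*\in G_1$ put $t_f=(g,m_j)$. Let $W_G$ be the smallest subset of $c_{00}(\mathbb N)$ that contains $G$ and contains $\frac12\sum_{i=1}^kf_i$ whenever $k\geq 1$,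 $f_1,\dots,f_k$ belong to it and $k\le\operatorname{supp}f_1<\dots<\operatorname{supp}f_k$. A *tree analysis* of $f\in W_G$ is a family $(f_\alpha)_{\alpha\in\mathcal A}$ indexed by a finite rooted tree $\mathcal{A}$, with $f$ at the root, $f_\alpha\in G$ at every maximal node, and at every other node $f_\alpha=\frac12\sum_{i=1}^kf_{\alpha_i}$, where $\alpha_1,\dots,\alpha_k$ are the immediate successors of $\alpha$ and $k\le\operatorname{supp}f_{\alpha_1}<\dots<\operatorname{supp}f_{\alpha_k}$. Let $W$ be the set of all $f\in W_G$ that have a tree analysis for which $\{t_{f_\alpha}:\alpha\text{ maximal},\ f_\alpha\in G_1\}$ is an essentially incomparable subset of $\mathcal T_\xi$. Let $T^\xi_{ess\text{-}inc}$ be the completion of $c_{00}(\mathbb N)$ (over $\mathbb R$) under $\|x\|_W=\sup\{f(x):f\in W\}$. Then, for every countable ordinal $\xi$ and all choices as above, the Banach space $T^\xi_{ess\text{-}inc}$ is reflexive. -/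

import Mathlib

noncomputable section

namespace EssInc

/-! The positive integers `{1, 2, …}` are `ℕ+`, and `c₀₀` is `ℕ+ →₀ ℝ`. -/

/-- `s < t` for finite sets of positive integers: every element of `s` is smaller than every
element of `t` (in particular whenever one of them is empty). -/
def Before (s t : Finset ℕ+) : Prop := ∀ x ∈ s, ∀ y ∈ t, x < y

/-- `k ≤ s` for a natural number `k` and a finite set `s`. -/
def AtLeast (k : ℕ) (s : Finset ℕ+) : Prop := ∀ x ∈ s, k ≤ (x : ℕ)

/-- The Schreier families `𝓢_ξ`, by transfinite recursion, for a fixed choice `a` of sequences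
`(a lam j)_j` increasing to the limit ordinals `lam`. -/
def schreier (a : Ordinal.{0} → ℕ+ → Ordinal.{0}) (ξ : Ordinal.{0}) : Set (Finset ℕ+) :=
  Ordinal.limitRecOn (motive := fun _ => Set (Finset ℕ+)) ξ
    {E | E = ∅ ∨ ∃ n, E = {n}}
    (fun _ S => {E | ∃ (k : ℕ) (F : Fin k → Finset ℕ+),
      (∀ i, F i ∈ S) ∧ (∀ i j, i < j → Before (F i) (F j)) ∧ (∀ i, AtLeast k (F i)) ∧
        E = Finset.univ.biUnion F})
    (fun lam _ S => {E | ∃ (j : ℕ+) (h : a lam j < lam), E ∈ S (a lam j) h ∧ AtLeast j E})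

/-- Finitely supported functions `g : ℕ+ → {-1, 0, 1}`. -/
abbrev SignFn : Type := ℕ+ →₀ SignType

/-- A pair `(g, j)`, which stands for the pair `(g, m_j)`; since `(m_j)_j` is strictly increasing,
a weight `m_j` and its index `j` determine each other. -/
abbrev WPair : Type := SignFn × ℕ

/-- The collection `𝓠` of the finite sequences `((g₁, m_{j₁}), …, (g_k, m_{j_k}))`, `k ≥ 1`, with
positive indices and `m_{j₁} < ⋯ < m_{j_k}`. -/
def codingDomain : Set (List WPair) :=
  {s | s ≠ [] ∧ (∀ p ∈ s, 1 ≤ p.2) ∧ s.Pairwise (fun p q => p.2 < q.2)}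

/-- The choices that are fixed in the construction: the sequences defining the Schreier families at
countable limit ordinals, a countable ordinal `ξ`, the sequences `(m_j)`, `(n_j)`, and the coding
injection `σ` (`σ s = j` stands for the value `m_j`). -/
structure Choices where
  /-- the sequence `(a lam j)_j` in `[1, lam)` increasing to the limit ordinal `lam` -/
  a : Ordinal.{0} → ℕ+ → Ordinal.{0}
  a_mono : ∀ lam < Ordinal.omega 1, Order.IsSuccLimit lam → StrictMono (a lam)
  a_mem : ∀ lam < Ordinal.omega 1, Order.IsSuccLimit lam → ∀ j, 1 ≤ a lam j ∧ a lam j < lam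
  a_lim : ∀ lam < Ordinal.omega 1, Order.IsSuccLimit lam → IsLUB (Set.range (a lam)) lam
  /-- the countable ordinal -/
  ξ : Ordinal.{0}
  ξ_lt : ξ < Ordinal.omega 1
  /-- the weights -/
  m : ℕ → ℕ
  m_mono : StrictMono m
  m_zero : m 0 = 2
  m_one : m 1 = 4
  m_sq : ∀ j, 2 ≤ j → m (j - 1) ^ 2 ≤ m j
  /-- the Schreier indices -/
  n : ℕ → ℕ
  n_mono : StrictMono n
  n_zero : n 0 = 1
  n_one : n 1 = 6
  n_log : ∀ j, 2 ≤ j → Real.logb 2 ((m j : ℝ) ^ 2) + (n (j - 1) : ℝ) < (n j : ℝ)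
  /-- the coding function -/
  σ : List WPair → ℕ
  σ_inj : Set.InjOn σ codingDomain
  σ_gt : ∀ s ∈ codingDomain, ∀ p ∈ s.getLast?, p.2 < σ s

namespace Choices

variable (D : Choices)

/-- The family `𝓢_α` for the fixed choices. -/
def S (α : Ordinal.{0}) : Set (Finset ℕ+) := schreier D.a α

/-- The tree of all finite sequences `((g₁, m_{j₁}), …, (g_k, m_{j_k}))`, `k ≥ 1`, of nonzero
`g_i` with successive supports `supp g_i ∈ 𝓢_{n_{j_i}}`, with `j₁ = 1`, increasing indices,
`m_{j_i} = σ ((g₁, m_{j₁}), …, (g_{i-1}, m_{j_{i-1}}))` for `i ≥ 2`, and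
`{min supp g_i : i ≤ k} ∈ 𝓢_ξ`. It is ordered by the initial segment order `<+:`. -/
def seqTree : Set (List WPair) :=
  {L | L ≠ [] ∧ (∀ p ∈ L, p.1 ≠ 0) ∧
    L.Pairwise (fun p q => Before p.1.support q.1.support) ∧
    (∀ p ∈ L, p.1.support ∈ D.S (D.n p.2 : Ordinal)) ∧
    L.Pairwise (fun p q => D.n p.2 < D.n q.2) ∧
    (∀ p ∈ L.head?, p.2 = 1) ∧
    (∀ (i : ℕ) (hi : i < L.length), 1 ≤ i → (L[i]).2 = D.σ (L.take i)) ∧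
    ∃ F ∈ D.S D.ξ, (F : Set ℕ+) = {k | ∃ p ∈ L, IsLeast (p.1.support : Set ℕ+) k}}

/-- The set `𝓣_ξ` of the last entries `t = (g_t, m_{j_t})` of the sequences in the tree. -/
def nodes : Set WPair := {t | ∃ L ∈ D.seqTree, L.getLast? = some t}

/-- The order of `𝓣_ξ` induced by the initial segment order. -/
def NodeLE (t₁ t₂ : WPair) : Prop :=
  ∃ L₁ ∈ D.seqTree, ∃ L₂ ∈ D.seqTree,
    L₁.getLast? = some t₁ ∧ L₂.getLast? = some t₂ ∧ L₁ <+: L₂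

/-- The order of the set `𝓦_ξ` of the weights of nodes: `m_i ≤ m_j` if these are the weights of
two nodes `t₁ ≤ t₂`. -/
def WeightLE (i j : ℕ) : Prop :=
  ∃ t₁ t₂ : WPair, D.NodeLE t₁ t₂ ∧ t₁.2 = i ∧ t₂.2 = j

/-- The strict order of `𝓦_ξ`. -/
def WeightLT (i j : ℕ) : Prop := D.WeightLE i j ∧ i ≠ j

/-- Essentially incomparable subsets of `𝓣_ξ`: whenever `t₁, t₂ ∈ X` and the weight of `t₁` is
strictly below that of `t₂`, the `g` with `(g, m_{j_{t₁}}) ≤ t₂` (there is exactly one, as `σ` is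
injective) satisfies `supp g < supp g_{t₁}`. -/
def EssentiallyIncomparable (X : Set WPair) : Prop :=
  X ⊆ D.nodes ∧ ∀ t₁ ∈ X, ∀ t₂ ∈ X, D.WeightLT t₁.2 t₂.2 →
    ∀ g : SignFn, D.NodeLE (g, t₁.2) t₂ → Before g.support t₁.1.support

/-- The functional `m_j⁻¹ ∑ g(n) e_n^*`. -/
def weighted (p : WPair) : ℕ+ →₀ ℝ :=
  p.1.mapRange (fun s : SignType => (D.m p.2 : ℝ)⁻¹ * (s : ℝ)) (by simp)

/-- The pairs `(g, m_j)`, `j ≥ 1`, that define the functionals in `G₁`. -/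
def weightedPairs : Set WPair := {p | 1 ≤ p.2 ∧ p.1.support ∈ D.S (D.n p.2 : Ordinal)}

/-- `G₀ = {± e_n^*}`. -/
def G₀ : Set (ℕ+ →₀ ℝ) :=
  {f | ∃ n, f = Finsupp.single n (1 : ℝ) ∨ f = -Finsupp.single n (1 : ℝ)}

/-- `G₁ = {m_j⁻¹ ∑ g(n) e_n^* : j ≥ 1, supp g ∈ 𝓢_{n_j}}`. -/
def G₁ : Set (ℕ+ →₀ ℝ) := D.weighted '' D.weightedPairs

/-- The ground set `G = G₀ ∪ G₁`. -/
def ground : Set (ℕ+ →₀ ℝ) := G₀ ∪ D.G₁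

end Choices

/-- `f₁, …, f_k` is admissible: `k ≤ supp f₁ < ⋯ < supp f_k`. (The comparisons are required for all
the supports and all pairs, so that zero functionals do not void them.) -/
def Admissible {k : ℕ} (f : Fin k → (ℕ+ →₀ ℝ)) : Prop :=
  (∀ i, AtLeast k (f i).support) ∧ ∀ i j, i < j → Before (f i).support (f j).support

/-- Closedness under the `(𝓢, 1/2)`-operation. -/
def ClosedUnderHalfSums (V : Set (ℕ+ →₀ ℝ)) : Prop :=
  ∀ (k : ℕ) (f : Fin k → (ℕ+ →₀ ℝ)), 0 < k → (∀ i, f i ∈ V) → Admissible f →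
    (1 / 2 : ℝ) • ∑ i, f i ∈ V

/-- The Tsirelson extension `W_G` of `G`: the smallest set that contains `G` and is closed under the
`(𝓢, 1/2)`-operation. -/
def tsirelsonExtension (G : Set (ℕ+ →₀ ℝ)) : Set (ℕ+ →₀ ℝ) :=
  ⋂₀ {V | G ⊆ V ∧ ClosedUnderHalfSums V}

/-- Finite trees whose maximal nodes carry functionals. -/
inductive FTree : Type
  | leaf (f : ℕ+ →₀ ℝ) : FTree
  | node (k : ℕ) (c : Fin k → FTree) : FTree

namespace FTree

/-- The functional at the root: `f_α = ½ ∑ f_s` over the immediate successors `s` of `α`. -/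
def value : FTree → (ℕ+ →₀ ℝ)
  | leaf f => f
  | node _ c => (1 / 2 : ℝ) • ∑ i, (c i).value

/-- The set of the functionals at the maximal nodes. -/
def leaves : FTree → Set (ℕ+ →₀ ℝ)
  | leaf f => {f}
  | node _ c => ⋃ i, (c i).leaves

/-- The tree is a tree analysis with respect to `G` (of its value): maximal nodes carry elements
of `G`, and the functionals at the immediate successors of any other node are admissible. -/
def IsAnalysis (G : Set (ℕ+ →₀ ℝ)) : FTree → Prop
  | leaf f => f ∈ G
  | node k c => 0 < k ∧ (∀ i, (c i).IsAnalysis G) ∧ Admissible (fun i => (c i).value)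

end FTree

namespace Choices

variable (D : Choices)

/-- The set `{t_{f_α} : α ∈ 𝓜¹_f}` of a tree analysis: the pairs `(g, m_j)` that define those of
the functionals at the maximal nodes that lie in `G₁`. -/
def leafPairs (A : FTree) : Set WPair := {t | t ∈ D.weightedPairs ∧ D.weighted t ∈ A.leaves}

/-- The norming set `W`: all `f ∈ W_G` with a tree analysis for which `{t_{f_α} : α ∈ 𝓜¹_f}` is
an essentially incomparable subset of `𝓣_ξ`. -/
def W : Set (ℕ+ →₀ ℝ) :=
  {f | f ∈ tsirelsonExtension D.ground ∧ ∃ A : FTree, A.IsAnalysis D.ground ∧ A.value = f ∧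
    D.EssentiallyIncomparable (D.leafPairs A)}

end Choices

/-- `f(x) = ∑ f(n) x(n)`. -/
def pairing (f x : ℕ+ →₀ ℝ) : ℝ := ∑ i ∈ x.support, f i * x i

theorem pairing_eq_sum (f x : ℕ+ →₀ ℝ) {s : Finset ℕ+} (h : x.support ⊆ s) :
    pairing f x = ∑ i ∈ s, f i * x i := by
  refine Finset.sum_subset h fun i _ hi => ?_
  rw [Finsupp.notMem_support_iff.mp hi, mul_zero]

theorem pairing_add (f x y : ℕ+ →₀ ℝ) : pairing f (x + y) = pairing f x + pairing f y := by
  classical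
  rw [pairing_eq_sum f (x + y) (s := x.support ∪ y.support) Finsupp.support_add,
    pairing_eq_sum f x (s := x.support ∪ y.support) Finset.subset_union_left,
    pairing_eq_sum f y (s := x.support ∪ y.support) Finset.subset_union_right,
    ← Finset.sum_add_distrib]
  exact Finset.sum_congr rfl fun i _ => by rw [Finsupp.add_apply, mul_add]

theorem pairing_smul (f : ℕ+ →₀ ℝ) (c : ℝ) (x : ℕ+ →₀ ℝ) :
    pairing f (c • x) = c * pairing f x := by
  rw [pairing_eq_sum f (c • x) Finsupp.support_smul, pairing, Finset.mul_sum]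
  exact Finset.sum_congr rfl fun i _ => by
    rw [Finsupp.smul_apply, smul_eq_mul]; ring

namespace Choices

variable (D : Choices)

theorem abs_ground_le {f : ℕ+ →₀ ℝ} (hf : f ∈ D.ground) (i : ℕ+) : |f i| ≤ 1 := by
  rcases hf with ⟨n, rfl | rfl⟩ | ⟨p, -, rfl⟩
  · rw [Finsupp.single_apply]; split_ifs <;> simp
  · rw [Finsupp.neg_apply, Finsupp.single_apply]; split_ifs <;> simp
  · have hm : (1 : ℝ) ≤ D.m p.2 := by
      have h0 : D.m 0 ≤ D.m p.2 := D.m_mono.monotone (Nat.zero_le _)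
      rw [D.m_zero] at h0
      exact_mod_cast (by omega : 1 ≤ D.m p.2)
    have hs : ∀ s : SignType, |(s : ℝ)| ≤ 1 := by
      intro s; cases s <;> simp
    rw [weighted, Finsupp.mapRange_apply, abs_mul, abs_inv, Nat.abs_cast]
    exact mul_le_one₀ (inv_le_one_of_one_le₀ hm) (abs_nonneg _) (hs _)

end Choices

theorem closedUnderHalfSums_unitBall :
    ClosedUnderHalfSums {f : ℕ+ →₀ ℝ | ∀ i, |f i| ≤ 1} := by
  intro k f _ hf hadm i
  have hsum : |∑ l, f l i| ≤ 1 := by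
    by_cases h : ∃ l, f l i ≠ 0
    · obtain ⟨l, hl⟩ := h
      rw [Finset.sum_eq_single l]
      · exact hf l i
      · intro l' _ hne
        by_contra hl'
        have h1 := Finsupp.mem_support_iff.mpr hl
        have h2 := Finsupp.mem_support_iff.mpr hl'
        rcases lt_or_gt_of_ne hne with hlt | hlt
        · exact lt_irrefl _ (hadm.2 _ _ hlt i h2 i h1)
        · exact lt_irrefl _ (hadm.2 _ _ hlt i h1 i h2)
      · intro hl'; exact absurd (Finset.mem_univ l) hl'
    · push Not at h
      simp [h]
  rw [Finsupp.smul_apply, Finsupp.finsetSum_apply, smul_eq_mul, abs_mul]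
  have : |(1 / 2 : ℝ)| = 1 / 2 := abs_of_pos (by norm_num)
  rw [this]
  nlinarith [abs_nonneg (∑ l, f l i)]

namespace Choices

variable (D : Choices)

theorem abs_apply_le {f : ℕ+ →₀ ℝ} (hf : f ∈ D.W) (i : ℕ+) : |f i| ≤ 1 :=
  hf.1 {f : ℕ+ →₀ ℝ | ∀ i, |f i| ≤ 1}
    ⟨fun _ hg i => D.abs_ground_le hg i, closedUnderHalfSums_unitBall⟩ i

/-- The norm `‖x‖_W = sup {|f(x)| : f ∈ W}`; it equals `sup {f(x) : f ∈ W}` because `W` is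
symmetric. -/
def normW (x : ℕ+ →₀ ℝ) : ℝ := ⨆ f : D.W, |pairing f.1 x|

theorem bddAbove_normW (x : ℕ+ →₀ ℝ) :
    BddAbove (Set.range fun f : D.W => |pairing f.1 x|) := by
  refine ⟨∑ i ∈ x.support, |x i|, ?_⟩
  rintro _ ⟨f, rfl⟩
  refine (Finset.abs_sum_le_sum_abs _ _).trans (Finset.sum_le_sum fun i _ => ?_)
  rw [abs_mul]
  exact mul_le_of_le_one_left (abs_nonneg _) (D.abs_apply_le f.2 i)

/-- `‖·‖_W` as a seminorm on `c₀₀`. -/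
def seminormW : Seminorm ℝ (ℕ+ →₀ ℝ) :=
  Seminorm.ofSMulLE D.normW (by simp [normW, pairing])
    (fun x y => by
      refine Real.iSup_le (fun f => ?_) ?_
      · rw [pairing_add]
        exact (abs_add_le _ _).trans
          (add_le_add (le_ciSup (D.bddAbove_normW x) f) (le_ciSup (D.bddAbove_normW y) f))
      · exact add_nonneg (Real.iSup_nonneg fun _ => abs_nonneg _)
          (Real.iSup_nonneg fun _ => abs_nonneg _))
    (fun c x => by
      refine Real.iSup_le (fun f => ?_) ?_
      · rw [pairing_smul, abs_mul]
        exact mul_le_mul_of_nonneg_left (le_ciSup (D.bddAbove_normW x) f) (abs_nonneg c)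
      · exact mul_nonneg (norm_nonneg c) (Real.iSup_nonneg fun _ => abs_nonneg _))

end Choices

/-- The vector space `c₀₀`, to be normed by `‖·‖_W`. -/
def C00 (_ : Choices) : Type := ℕ+ →₀ ℝ

instance (D : Choices) : AddCommGroup (C00 D) := inferInstanceAs (AddCommGroup (ℕ+ →₀ ℝ))

instance (D : Choices) : Module ℝ (C00 D) := inferInstanceAs (Module ℝ (ℕ+ →₀ ℝ))

instance (D : Choices) : SeminormedAddCommGroup (C00 D) :=
  AddGroupSeminorm.toSeminormedAddCommGroup (E := C00 D) D.seminormW.toAddGroupSeminorm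

instance (D : Choices) : NormedSpace ℝ (C00 D) where
  norm_smul_le c x := le_of_eq (map_smul_eq_mul D.seminormW c x)

/-- The space `T^ξ_{ess-inc}`: the completion of `(c₀₀, ‖·‖_W)`. -/
abbrev TEssInc (D : Choices) : Type := UniformSpace.Completion (C00 D)

/-- A real normed space is reflexive if its canonical embedding into its bidual is onto. -/
def IsReflexiveSpace (X : Type*) [NormedAddCommGroup X] [NormedSpace ℝ X] : Prop :=
  Function.Surjective (NormedSpace.inclusionInDoubleDual ℝ X)

end EssInc

end

noncomputable section

namespace EssInc

/-! ### Schreier families: hereditary, spreading, compact. -/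

section Schreier

variable (a : Ordinal.{0} → ℕ+ → Ordinal.{0})

/-! The unit vector basis `(e_n)` is shown to be both boundedly complete and shrinking; reflexivity
then follows as in James' theorem. Given `ξ` in the bidual, the partial sums of `∑ ξ(e_n^*) e_n` are
bounded (`normW_sum_bidual_le`), so the series converges to some `z` by bounded completeness
(`summable_of_bounded`). Every functional `φ` is the norm limit of `∑ φ(e_n) e_n^*` because the
basis is shrinking (`hasSum_coord`). Evaluating `ξ` on this series gives `ξ(φ) = φ(z)`.

Bounded completeness rests on `exists_lt_normW_sum`. Norm each block `x_i`, all of norm above `δ`,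
by some `f_i` in `W`, and split `f_i(x_i)` according to the weights of the leaves of a tree
analysis. The order of the weights is well founded upwards, since an infinite chain would give an
infinite set with all finite subsets in `𝓢_ξ`. Hence (`exists_incomparable_of_mass`) infinitely many
`f_i` can be restricted to sets of weights that are pairwise incomparable without losing more than a
fixed share of the mass. Half the sum of `N` such restrictions, supported beyond `N`, stays in `W`
and acts on the sum of the blocks with value at least `Nε/2`.

The basis is shrinking because every pointwise limit `F` of `W` either has finite support or, off a
finite set, is half of another such limit (`finite_or_eventually_half`). Iterating, `F` is at most
`2^{-k}` on normalized vectors supported far out. So a bounded sequence with supports tending to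
infinity tends to `0` pointwise on the compact closure of `W`. A Hahn–Banach, Riesz and dominated
convergence argument gives convex combinations of small norm, on which no functional can stay
bounded below. -/

theorem schreier_zero : schreier a 0 = {E | E = ∅ ∨ ∃ n, E = {n}} := by
  rw [schreier, Ordinal.limitRecOn_zero]

theorem schreier_add_one (α : Ordinal.{0}) : schreier a (α + 1) =
    {E | ∃ (k : ℕ) (F : Fin k → Finset ℕ+),
      (∀ i, F i ∈ schreier a α) ∧ (∀ i j, i < j → Before (F i) (F j)) ∧ (∀ i, AtLeast k (F i)) ∧
        E = Finset.univ.biUnion F} := by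
  rw [schreier, Ordinal.limitRecOn_add_one]
  rfl

theorem schreier_limit {lam : Ordinal.{0}} (h : Order.IsSuccLimit lam) : schreier a lam =
    {E | ∃ (j : ℕ+) (_ : a lam j < lam), E ∈ schreier a (a lam j) ∧ AtLeast j E} := by
  rw [schreier, Ordinal.limitRecOn_limit _ _ _ _ h]
  rfl

/-- The Schreier families are hereditary. -/
theorem schreier_subset {α : Ordinal.{0}} {E F : Finset ℕ+} (hE : E ∈ schreier a α)
    (hF : F ⊆ E) : F ∈ schreier a α := by
  classical
  induction α using Ordinal.limitRecOn generalizing E F with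
  | zero =>
    rw [schreier_zero] at hE ⊢
    rcases hE with rfl | ⟨n, rfl⟩
    · exact Or.inl (Finset.subset_empty.mp hF)
    · rcases Finset.subset_singleton_iff.mp hF with h | h
      · exact Or.inl h
      · exact Or.inr ⟨n, h⟩
  | add_one α ih =>
    rw [schreier_add_one] at hE ⊢
    obtain ⟨k, G, h1, h2, h3, rfl⟩ := hE
    refine ⟨k, fun i => G i ∩ F, fun i => ih (h1 i) Finset.inter_subset_left,
      fun i j hij x hx y hy => h2 i j hij x (Finset.mem_inter.mp hx).1 y (Finset.mem_inter.mp hy).1,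
      fun i x hx => h3 i x (Finset.mem_inter.mp hx).1, ?_⟩
    rw [← Finset.biUnion_inter, Finset.inter_eq_right.mpr hF]
  | limit lam hlam ih =>
    rw [schreier_limit a hlam] at hE ⊢
    obtain ⟨j, hj, h1, h2⟩ := hE
    exact ⟨j, hj, ih _ hj h1 hF, fun x hx => h2 x (hF hx)⟩

/-- The Schreier families are spreading. -/
theorem schreier_image {α : Ordinal.{0}} {E : Finset ℕ+} (hE : E ∈ schreier a α)
    {φ : ℕ+ → ℕ+} (hφ : StrictMono φ) : E.image φ ∈ schreier a α := by
  classical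
  induction α using Ordinal.limitRecOn generalizing E with
  | zero =>
    rw [schreier_zero] at hE ⊢
    rcases hE with rfl | ⟨n, rfl⟩
    · exact Or.inl rfl
    · exact Or.inr ⟨φ n, by simp⟩
  | add_one α ih =>
    rw [schreier_add_one] at hE ⊢
    obtain ⟨k, G, h1, h2, h3, rfl⟩ := hE
    refine ⟨k, fun i => (G i).image φ, fun i => ih (h1 i), ?_, ?_, Finset.biUnion_image⟩
    · intro i j hij x hx y hy
      obtain ⟨x', hx', rfl⟩ := Finset.mem_image.mp hx
      obtain ⟨y', hy', rfl⟩ := Finset.mem_image.mp hy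
      exact hφ (h2 i j hij x' hx' y' hy')
    · intro i x hx
      obtain ⟨x', hx', rfl⟩ := Finset.mem_image.mp hx
      exact (h3 i x' hx').trans (PNat.coe_le_coe _ _ |>.mpr (hφ.le_apply))
  | limit lam hlam ih =>
    rw [schreier_limit a hlam] at hE ⊢
    obtain ⟨j, hj, h1, h2⟩ := hE
    refine ⟨j, hj, ih _ hj h1, ?_⟩
    intro x hx
    obtain ⟨x', hx', rfl⟩ := Finset.mem_image.mp hx
    exact (h2 x' hx').trans (PNat.coe_le_coe _ _ |>.mpr (hφ.le_apply))

open Filter in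
/-- If the finite subsets of `M` can be coloured with boundedly many colours so that the colour
classes lie in hereditary families without infinite limits, then `M` is finite. -/
theorem finite_of_coloring {𝓕 : ℕ → Set (Finset ℕ+)}
    (her : ∀ i, ∀ E ∈ 𝓕 i, ∀ F ⊆ E, F ∈ 𝓕 i)
    (fin : ∀ i, ∀ M : Set ℕ+, (∀ A : Finset ℕ+, (A : Set ℕ+) ⊆ M → A ∈ 𝓕 i) → M.Finite)
    (M : Set ℕ+) (K : ℕ)
    (h : ∀ A : Finset ℕ+, (A : Set ℕ+) ⊆ M →
      ∃ c : ℕ+ → ℕ, (∀ x ∈ A, c x < K) ∧ ∀ i, A.filter (c · = i) ∈ 𝓕 i) : M.Finite := by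
  classical
  choose c hcK hc using fun A : Finset ℕ+ => h (A.filter (· ∈ M)) (by
    intro x hx; exact (Finset.mem_filter.mp hx).2)
  -- Along an ultrafilter finer than `atTop` the colourings of the finite sets `A ∩ M` converge:
  -- each point of `M` gets a limit colour, and any finitely many points of one limit colour are
  -- monochromatic for a common `A`.
  let U : Ultrafilter (Finset ℕ+) := Ultrafilter.of atTop
  have hU : (U : Filter (Finset ℕ+)) ≤ atTop := Ultrafilter.of_le _
  let N : ℕ → Set ℕ+ := fun i => {x | x ∈ M ∧ ∀ᶠ A in (U : Filter (Finset ℕ+)), c A x = i}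
  have hN : ∀ i, (N i).Finite := by
    intro i
    refine fin i _ fun B hB => ?_
    have h1 : ∀ᶠ A in (U : Filter (Finset ℕ+)), ∀ x ∈ B, c A x = i :=
      (Finset.eventually_all B).mpr fun x hx => (hB hx).2
    obtain ⟨A, hA1, hA2⟩ := (h1.and (hU (eventually_ge_atTop B))).exists
    refine her i _ (hc A i) B fun x hx => ?_
    rw [Finset.mem_filter, Finset.mem_filter]
    exact ⟨⟨hA2 hx, (hB hx).1⟩, hA1 x hx⟩
  refine ((Finset.range K).finite_toSet.biUnion fun i _ => hN i).subset fun x hx => ?_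
  have h1 : ∀ᶠ A in (U : Filter (Finset ℕ+)), ∃ i ∈ Finset.range K, c A x = i := by
    filter_upwards [hU (eventually_ge_atTop {x})] with A hA
    exact ⟨_, Finset.mem_range.mpr (hcK A x (Finset.mem_filter.mpr ⟨hA (by simp), hx⟩)), rfl⟩
  have h2 : ∃ i ∈ Finset.range K, ∀ᶠ A in (U : Filter (Finset ℕ+)), c A x = i := by
    have := (Ultrafilter.finite_biUnion_mem_iff (f := U) (Finset.range K).finite_toSet
      (s := fun i => {A | c A x = i})).mp (by
        filter_upwards [h1] with A hA
        simpa using hA)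
    exact this
  obtain ⟨i, hi, h3⟩ := h2
  exact Set.mem_biUnion hi ⟨hx, h3⟩

/-- The Schreier families are compact: they have no infinite limits. -/
theorem finite_of_forall_mem_schreier (α : Ordinal.{0}) (M : Set ℕ+)
    (h : ∀ A : Finset ℕ+, (A : Set ℕ+) ⊆ M → A ∈ schreier a α) : M.Finite := by
  classical
  induction α using Ordinal.limitRecOn generalizing M with
  | zero =>
    refine Set.Subsingleton.finite fun x hx y hy => ?_
    have := h {x, y} (by intro z; simp; rintro (rfl | rfl) <;> assumption)
    rw [schreier_zero] at this
    rcases this with h | ⟨n, hn⟩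
    · simp at h
    · have hx : x ∈ ({x, y} : Finset ℕ+) := by simp
      have hy : y ∈ ({x, y} : Finset ℕ+) := by simp
      rw [hn, Finset.mem_singleton] at hx hy
      rw [hx, hy]
  | add_one α ih =>
    rcases M.eq_empty_or_nonempty with rfl | ⟨m, hm⟩
    · exact Set.finite_empty
    refine finite_of_coloring (𝓕 := fun _ => schreier a α)
      (fun _ E hE F hF => schreier_subset a hE hF) (fun _ => ih) M m fun A hA => ?_
    -- Adjoining a fixed `m ∈ M` bounds the number `k` of pieces by `m`, whatever `A` is; the colour
    -- of a point is the index of a piece containing it.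
    have h1 := h (insert m A) (by
      intro x hx
      rcases Finset.mem_insert.mp hx with rfl | hx
      exacts [hm, hA hx])
    rw [schreier_add_one] at h1
    obtain ⟨k, F, h1, -, h3, h4⟩ := h1
    have hk : ∀ x ∈ insert m A, ∃ i, x ∈ F i := by
      intro x hx
      rw [h4] at hx
      simpa using hx
    obtain ⟨i₀, hi₀⟩ := hk m (Finset.mem_insert_self _ _)
    have hkm : k ≤ m := h3 i₀ m hi₀
    have : ∀ x, ∃ n : ℕ, x ∈ A → ∃ hn : n < k, x ∈ F ⟨n, hn⟩ := by
      intro x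
      by_cases hx : x ∈ A
      · obtain ⟨i, hi⟩ := hk x (Finset.mem_insert_of_mem hx)
        exact ⟨i, fun _ => ⟨i.2, hi⟩⟩
      · exact ⟨0, fun h => absurd h hx⟩
    choose c hc using this
    refine ⟨c, fun x hx => (hc x hx).1.trans_le hkm, fun i => ?_⟩
    by_cases hi : i < k
    · refine schreier_subset a (h1 ⟨i, hi⟩) fun x hx => ?_
      obtain ⟨hxA, rfl⟩ := Finset.mem_filter.mp hx
      exact (hc x hxA).2
    · have : A.filter (c · = i) = ∅ := by
        refine Finset.filter_eq_empty_iff.mpr fun x hx hxi => hi ?_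
        rw [← hxi]
        exact (hc x hx).1
      simp only [this]
      exact schreier_subset a (h1 i₀) (Finset.empty_subset _)
  | limit lam hlam ih =>
    rcases M.eq_empty_or_nonempty with rfl | ⟨m, hm⟩
    · exact Set.finite_empty
    refine finite_of_coloring
      (𝓕 := fun i => {A | A = ∅ ∨ ∃ j : ℕ+, (j : ℕ) = i ∧ a lam j < lam ∧ A ∈ schreier a (a lam j)})
      ?_ ?_ M (m + 1) fun A hA => ?_
    · rintro i E (rfl | ⟨j, h1, h2, h3⟩) F hF
      · exact Or.inl (Finset.subset_empty.mp hF)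
      · exact Or.inr ⟨j, h1, h2, schreier_subset a h3 hF⟩
    · intro i N hN
      rcases N.eq_empty_or_nonempty with rfl | ⟨n, hn⟩
      · exact Set.finite_empty
      rcases hN {n} (by simpa using hn) with h | ⟨j, hj, hlt, -⟩
      · simp at h
      refine ih _ hlt N fun A hA => ?_
      rcases hN (insert n A) (by
        intro x hx
        rcases Finset.mem_insert.mp hx with rfl | hx
        exacts [hn, hA hx]) with h | ⟨j', hj', -, h⟩
      · simp at h
      · obtain rfl : j = j' := PNat.coe_injective (hj.trans hj'.symm)
        exact schreier_subset a h (Finset.subset_insert _ _)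
    -- Here too the fixed `m` gives the bound `j ≤ m`; all of `A` gets the single colour `j`.
    · have h1 := h (insert m A) (by
        intro x hx
        rcases Finset.mem_insert.mp hx with rfl | hx
        exacts [hm, hA hx])
      rw [schreier_limit a hlam] at h1
      obtain ⟨j, hj, h1, h2⟩ := h1
      refine ⟨fun _ => j, fun _ _ => Nat.lt_succ_of_le (h2 m (Finset.mem_insert_self _ _)),
        fun i => ?_⟩
      by_cases hi : (j : ℕ) = i
      · exact Or.inr ⟨j, hi, hj, schreier_subset a h1
          ((Finset.filter_subset _ _).trans (Finset.subset_insert _ _))⟩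
      · exact Or.inl (Finset.filter_eq_empty_iff.mpr fun _ _ => hi)

end Schreier

/-! ### The coding tree and the order of the weights. -/

theorem isLeast_support_min' {g : SignFn} (hg : g ≠ 0) :
    IsLeast (g.support : Set ℕ+) (g.support.min' (Finsupp.support_nonempty_iff.mpr hg)) :=
  ⟨Finset.min'_mem _ _, fun _ hx => Finset.min'_le _ _ hx⟩

/-- `t'` arises from `t` by shrinking the support to a nonempty set and changing signs. -/
def Refines (t' t : WPair) : Prop := t'.2 = t.2 ∧ t'.1 ≠ 0 ∧ t'.1.support ⊆ t.1.support

/-- The identity below `b`, followed by a translation. With the spreading property of `𝓢_ξ` it moves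
the last minimum of a branch to the right and keeps the earlier ones. -/
theorem exists_strictMono_map {b b' : ℕ+} (h : b ≤ b') :
    ∃ φ : ℕ+ → ℕ+, StrictMono φ ∧ (∀ x < b, φ x = x) ∧ φ b = b' := by
  rcases h.eq_or_lt with rfl | h
  · exact ⟨id, strictMono_id, fun _ _ => rfl, rfl⟩
  refine ⟨fun x => if x < b then x else x + (b' - b), ?_, fun x hx => if_pos hx, ?_⟩
  · intro x y hxy
    dsimp only
    split_ifs with h1 h2 h2
    · exact hxy
    · exact hxy.trans (PNat.lt_add_right y _)
    · exact absurd (hxy.trans h2) h1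
    · exact add_lt_add_left hxy _
  · simp [PNat.add_sub_of_lt h]

namespace Choices

variable {D : Choices}

theorem seqTree_codingDomain {L : List WPair} (hL : L ∈ D.seqTree) : L ∈ codingDomain := by
  obtain ⟨h0, -, -, -, h4, h5, -, -⟩ := hL
  have h4' : L.Pairwise (fun p q : WPair => p.2 < q.2) :=
    h4.imp fun {p q} h => D.n_mono.lt_iff_lt.mp h
  refine ⟨h0, ?_, h4'⟩
  cases L with
  | nil => simp
  | cons q L =>
    have hq : q.2 = 1 := h5 q (by simp)
    intro p hp
    rcases List.mem_cons.mp hp with rfl | hp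
    · exact hq.ge
    · have := (List.pairwise_cons.mp h4').1 p hp
      omega

theorem seqTree_prefix {L L' : List WPair} (hL : L ∈ D.seqTree) (h : L' <+: L) (hne : L' ≠ []) :
    L' ∈ D.seqTree := by
  classical
  obtain ⟨-, h1, h2, h3, h4, h5, h6, F, hF, hFL⟩ := hL
  have hs := h.subset
  refine ⟨hne, fun p hp => h1 p (hs hp), h2.sublist h.sublist, fun p hp => h3 p (hs hp),
    h4.sublist h.sublist, ?_, ?_, ?_⟩
  · obtain ⟨M, rfl⟩ := h
    cases L' with
    | nil => exact absurd rfl hne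
    | cons q L' => simpa using h5
  · intro i hi hi1
    have := h6 i (hi.trans_le h.length_le) hi1
    rw [h.getElem hi, this, List.prefix_iff_eq_take.mp h, List.take_take, min_eq_left hi.le]
  · refine ⟨F.filter (fun k => ∃ p ∈ L', IsLeast (p.1.support : Set ℕ+) k),
      schreier_subset D.a hF (Finset.filter_subset _ _), ?_⟩
    ext k
    simp only [Finset.coe_filter, Set.mem_ofPred_eq, and_iff_right_iff_imp]
    rintro ⟨p, hp, hk⟩
    rw [← Finset.mem_coe, hFL]
    exact ⟨p, hs hp, hk⟩

theorem weight_eq_σ {L : List WPair} {t : WPair} (h : L ++ [t] ∈ D.seqTree) (hL : L ≠ []) :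
    t.2 = D.σ L := by
  obtain ⟨-, -, -, -, -, -, h6, -⟩ := h
  have := h6 L.length (by simp) (List.length_pos_iff.mpr hL)
  simpa using this

/-- The weight of a node determines its strict predecessors. -/
theorem eq_of_weight_eq {L L' : List WPair} {t t' : WPair} (h : L ++ [t] ∈ D.seqTree)
    (h' : L' ++ [t'] ∈ D.seqTree) (ht : t.2 = t'.2) : L = L' := by
  have key : ∀ {L : List WPair} {t : WPair}, L ++ [t] ∈ D.seqTree → (L = [] ∧ t.2 = 1) ∨
      (L ≠ [] ∧ L ∈ codingDomain ∧ t.2 = D.σ L ∧ 1 < t.2) := by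
    intro L t h
    rcases eq_or_ne L [] with rfl | hL
    · obtain ⟨-, -, -, -, -, h5, -⟩ := h
      exact Or.inl ⟨rfl, h5 t (by simp)⟩
    · have hc := seqTree_codingDomain (seqTree_prefix h (List.prefix_append _ _) hL)
      -- A non-root weight is a value of `σ` exceeding an index that is at least `1`, so it cannot
      -- be confused with the root weight `1`.
      have hlast := D.σ_gt L hc (L.getLast hL) (List.getLast?_eq_getLast_of_ne_nil hL ▸ rfl)
      have h1 := hc.2.1 _ (List.getLast_mem hL)
      have h2 := weight_eq_σ h hL
      exact Or.inr ⟨hL, hc, h2, by omega⟩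
  rcases key h with ⟨h1, h2⟩ | ⟨h1, h2, h3, h4⟩ <;> rcases key h' with ⟨k1, k2⟩ | ⟨k1, k2, k3, k4⟩
  · rw [h1, k1]
  · omega
  · omega
  · exact D.σ_inj h2 k2 (by rw [← h3, ← k3, ht])

/-- The last entry of a branch is never fed to `σ`, so changing it within its support affects only
the Schreier conditions. Membership in `𝓢_{n_j}` is hereditary, and the set of minima changes only
in its last point, which moves right. -/
theorem seqTree_refine {L : List WPair} {t t' : WPair} (h : L ++ [t] ∈ D.seqTree)
    (ht : Refines t' t) : L ++ [t'] ∈ D.seqTree := by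
  classical
  have hfull := h
  obtain ⟨-, h1, h2, h3, h4, h5, h6, F, hF, hFL⟩ := h
  obtain ⟨r1, r2, r3⟩ := ht
  rw [List.pairwise_append] at h2 h4
  refine ⟨by simp, ?_, ?_, ?_, ?_, ?_, ?_, ?_⟩
  · intro p hp
    rcases List.mem_append.mp hp with hp | hp
    · exact h1 p (List.mem_append_left _ hp)
    · rw [List.mem_singleton.mp hp]; exact r2
  · refine List.pairwise_append.mpr ⟨h2.1, List.pairwise_singleton _ _, fun p hp q hq => ?_⟩
    rw [List.mem_singleton.mp hq]
    exact fun x hx y hy => h2.2.2 p hp t (by simp) x hx y (r3 hy)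
  · intro p hp
    rcases List.mem_append.mp hp with hp | hp
    · exact h3 p (List.mem_append_left _ hp)
    · rw [List.mem_singleton.mp hp, r1]
      exact schreier_subset D.a (h3 t (by simp)) r3
  · refine List.pairwise_append.mpr ⟨h4.1, List.pairwise_singleton _ _, fun p hp q hq => ?_⟩
    rw [List.mem_singleton.mp hq, r1]
    exact h4.2.2 p hp t (by simp)
  · cases L with
    | nil =>
      have : t.2 = 1 := h5 t (by simp)
      simp [r1, this]
    | cons q L => simpa using h5
  · intro i hi hi1
    rcases lt_or_ge i L.length with hlt | hge
    · have := h6 i (by simp; omega) hi1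
      rw [List.getElem_append_left hlt, List.take_append_of_le_length hlt.le] at this ⊢
      exact this
    · have hi : i = L.length := by simp at hi; omega
      subst hi
      have := weight_eq_σ hfull (List.length_pos_iff.mp hi1)
      simp [r1, this]
  · have hb := isLeast_support_min' (h1 t (by simp))
    have hb' := isLeast_support_min' r2
    obtain ⟨φ, hφ, hφ1, hφ2⟩ := exists_strictMono_map (hb.2 (r3 hb'.1))
    refine ⟨F.image φ, schreier_image D.a hF hφ, ?_⟩
    have hfix : ∀ p ∈ L, ∀ k, IsLeast (p.1.support : Set ℕ+) k → φ k = k := fun p hp k hk =>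
      hφ1 k (h2.2.2 p hp t (by simp) k hk.1 _ hb.1)
    rw [Finset.coe_image, hFL]
    ext k
    constructor
    · rintro ⟨k, ⟨p, hp, hk⟩, rfl⟩
      rcases List.mem_append.mp hp with hp' | hp'
      · exact ⟨p, List.mem_append_left _ hp', (hfix p hp' k hk).symm ▸ hk⟩
      · obtain rfl := List.mem_singleton.mp hp'
        refine ⟨t', by simp, ?_⟩
        rw [hk.unique hb, hφ2]
        exact hb'
    · rintro ⟨p, hp, hk⟩
      rcases List.mem_append.mp hp with hp' | hp'
      · exact ⟨k, ⟨p, List.mem_append_left _ hp', hk⟩, hfix p hp' k hk⟩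
      · obtain rfl := List.mem_singleton.mp hp'
        exact ⟨_, ⟨t, by simp, hb⟩, by rw [hφ2, hk.unique hb']⟩

theorem mem_nodes_iff {t : WPair} : t ∈ D.nodes ↔ ∃ L, L ++ [t] ∈ D.seqTree := by
  constructor
  · rintro ⟨L, hL, ht⟩
    exact ⟨L.dropLast, by rwa [List.dropLast_append_getLast? t ht]⟩
  · rintro ⟨L, hL⟩
    exact ⟨_, hL, by simp⟩

theorem nodes_refine {t t' : WPair} (h : t ∈ D.nodes) (ht : Refines t' t) : t' ∈ D.nodes := by
  obtain ⟨L, hL⟩ := mem_nodes_iff.mp h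
  exact mem_nodes_iff.mpr ⟨L, seqTree_refine hL ht⟩

/-- For distinct weights, the order of the tree reads off the strict predecessors. -/
theorem nodeLE_iff {t s : WPair} {L : List WPair} (hL : L ++ [t] ∈ D.seqTree) (hs : s.2 ≠ t.2) :
    D.NodeLE s t ↔ ∃ L₁, L₁ ++ [s] <+: L := by
  constructor
  · rintro ⟨L₁, h1, L₂, h2, e1, e2, hle⟩
    rw [← List.dropLast_append_getLast? t e2] at h2 hle
    rw [← List.dropLast_append_getLast? s e1] at hle
    rw [eq_of_weight_eq hL h2 rfl]
    rcases List.prefix_concat_iff.mp hle with h | h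
    · exact absurd (by rw [(List.append_inj' h rfl).2 |> List.singleton_inj.mp]) hs
    · exact ⟨_, h⟩
  · rintro ⟨L₁, h⟩
    have h' : L₁ ++ [s] <+: L ++ [t] := h.trans (List.prefix_append _ _)
    exact ⟨_, seqTree_prefix hL h' (by simp), _, hL, by simp, by simp, h'⟩

/-- Indices increase along branches. Consequently a weight has only finitely many predecessors. -/
theorem WeightLT.lt {i j : ℕ} (h : D.WeightLT i j) : i < j := by
  obtain ⟨⟨s, t, ⟨L₁, h1, L₂, h2, e1, e2, hle⟩, rfl, rfl⟩, hne⟩ := h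
  rw [← List.dropLast_append_getLast? t e2] at h2 hle
  rw [← List.dropLast_append_getLast? s e1] at hle
  rcases List.prefix_concat_iff.mp hle with h | h
  · exact absurd (by rw [(List.append_inj' h rfl).2 |> List.singleton_inj.mp]) hne
  · have := (List.pairwise_append.mp (seqTree_codingDomain h2).2.2).2.2 s (h.subset (by simp)) t
      (by simp)
    exact this

/-- The order of the weights has no infinite strictly increasing sequence. -/
theorem wellFounded_weightLT : WellFounded fun i j : ℕ => D.WeightLT j i := by
  classical
  refine wellFounded_iff_isEmpty_descending_chain.mpr ⟨fun ⟨w, hw⟩ => ?_⟩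
  have hpath : ∀ k, ∃ L t, L ++ [t] ∈ D.seqTree ∧ t.2 = w k := by
    intro k
    obtain ⟨⟨s, t, ⟨L₁, h1, L₂, h2, e1, e2, hle⟩, hs, ht⟩, -⟩ := hw k
    exact ⟨L₁.dropLast, s, by rwa [List.dropLast_append_getLast? s e1], hs⟩
  choose P t hP ht using hpath
  -- `P k` is the list of strict predecessors of any node of weight `w k`. As the weight determines
  -- it, the nodes witnessing consecutive comparisons fit together into one infinite branch.
  have hstep : ∀ k, P k <+: P (k + 1) ∧ (P k).length < (P (k + 1)).length := by
    intro k
    obtain ⟨⟨s, r, hle, hs, hr⟩, hne⟩ := hw k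
    have hr' : r ∈ D.nodes := by
      obtain ⟨L₁, h1, L₂, h2, e1, e2, -⟩ := hle
      exact ⟨L₂, h2, e2⟩
    have hs' : s ∈ D.nodes := by
      obtain ⟨L₁, h1, L₂, h2, e1, e2, -⟩ := hle
      exact ⟨L₁, h1, e1⟩
    obtain ⟨L, hL⟩ := mem_nodes_iff.mp hr'
    obtain ⟨L₁, h1⟩ := (nodeLE_iff hL (by rw [hs, hr]; exact hne)).mp hle
    have e1 : L = P (k + 1) := eq_of_weight_eq hL (hP _) (by rw [hr, ht])
    have e2 : L₁ = P k := by
      refine eq_of_weight_eq (seqTree_prefix hL (h1.trans (List.prefix_append _ _)) (by simp))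
        (hP k) (by rw [hs, ht])
    rw [e1, e2] at h1
    refine ⟨(List.prefix_append _ _).trans h1, ?_⟩
    have := h1.length_le
    simp at this
    omega
  have hmono : ∀ k l, k ≤ l → P k <+: P l := fun k l h => by
    induction l, h using Nat.le_induction with
    | base => exact List.prefix_refl _
    | succ l _ ih => exact ih.trans (hstep l).1
  have hlen : ∀ k, k ≤ (P k).length := fun k => by
    induction k with
    | zero => exact Nat.zero_le _
    | succ k ih => have := (hstep k).2; omega
  -- The minimum of the support; the value `1` for the zero function is never met on a branch.
  let m : WPair → ℕ+ := fun p => if h : p.1 ≠ 0 then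
    p.1.support.min' (Finsupp.support_nonempty_iff.mpr h) else 1
  have hm : ∀ p : WPair, p.1 ≠ 0 → IsLeast (p.1.support : Set ℕ+) (m p) := fun p hp => by
    simp only [m, dif_pos hp]
    exact isLeast_support_min' hp
  let M : Set ℕ+ := {x | ∃ k, ∃ p ∈ P k, x = m p}
  -- Any finitely many minima already occur in one `P k`, so they form a set in `𝓢_ξ`. Compactness
  -- makes `M` finite, whereas the minima in `P n` are at least `n` distinct points.
  have hfin : M.Finite := by
    refine finite_of_forall_mem_schreier D.a D.ξ M fun A hA => ?_
    choose! κ q hq hqm using fun x (hx : x ∈ A) => hA hx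
    obtain ⟨-, h1, -, -, -, -, -, F, hF, hFL⟩ := hP (A.sup κ)
    refine schreier_subset D.a hF fun x hx => ?_
    have hx' : q x ∈ P (A.sup κ) := (hmono _ _ (Finset.le_sup hx)).subset (hq x hx)
    have hx'' : q x ∈ P (A.sup κ) ++ [t (A.sup κ)] := List.mem_append_left _ hx'
    rw [← Finset.mem_coe, hFL]
    have hmin := hm (q x) (h1 _ hx'')
    rw [← hqm x hx] at hmin
    exact ⟨q x, hx'', hmin⟩
  let n := hfin.toFinset.card + 1
  have hnd : ((P n).map m).Nodup := by
    obtain ⟨-, h1, h2, -⟩ := hP n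
    refine (List.pairwise_map.mpr ?_)
    refine (List.pairwise_append.mp h2).1.imp_of_mem fun {p q} hp hq hpq => ?_
    exact (hpq _ (hm p (h1 p (List.mem_append_left _ hp))).1 _
      (hm q (h1 q (List.mem_append_left _ hq))).1).ne
  have hcard : ((P n).map m).toFinset.card ≤ hfin.toFinset.card := by
    refine Finset.card_le_card fun x hx => ?_
    obtain ⟨p, hp, rfl⟩ := List.mem_map.mp (List.mem_toFinset.mp hx)
    exact hfin.mem_toFinset.mpr ⟨n, p, hp, rfl⟩
  rw [List.toFinset_card_of_nodup hnd, List.length_map] at hcard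
  have := hlen n
  omega

namespace EssentiallyIncomparable

/-- The condition sees `t₂` only through its weight and strict predecessors, which refining
preserves, and it becomes weaker when the support of `t₁` shrinks. -/
theorem refine {X X' : Set WPair} (h : D.EssentiallyIncomparable X)
    (hX : ∀ t' ∈ X', ∃ t ∈ X, Refines t' t) : D.EssentiallyIncomparable X' := by
  refine ⟨fun t' ht' => ?_, fun t₁' h1 t₂' h2 hlt g hg => ?_⟩
  · obtain ⟨t, ht, hr⟩ := hX t' ht'
    exact nodes_refine (h.1 ht) hr
  · obtain ⟨t₁, ht₁, hr₁⟩ := hX t₁' h1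
    obtain ⟨t₂, ht₂, hr₂⟩ := hX t₂' h2
    rw [hr₁.1] at hg
    have hlt' := hlt
    rw [hr₁.1, hr₂.1] at hlt'
    obtain ⟨L, hL⟩ := mem_nodes_iff.mp (h.1 ht₂)
    have hg' : D.NodeLE (g, t₁.2) t₂ :=
      (nodeLE_iff (s := (g, t₁.2)) hL hlt'.2).mpr
        ((nodeLE_iff (s := (g, t₁.2)) (seqTree_refine hL hr₂) (by rw [hr₂.1]; exact hlt'.2)).mp hg)
    exact fun x hx y hy => h.2 t₁ ht₁ t₂ ht₂ hlt' g hg' x hx y (hr₁.2.2 hy)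

theorem iUnion {ι : Type*} {X : ι → Set WPair} (h : ∀ l, D.EssentiallyIncomparable (X l))
    (hX : ∀ l l', l ≠ l' → ∀ t ∈ X l, ∀ t' ∈ X l', ¬ D.WeightLT t.2 t'.2) :
    D.EssentiallyIncomparable (⋃ l, X l) := by
  refine ⟨Set.iUnion_subset fun l => (h l).1, fun t₁ h1 t₂ h2 hlt g hg => ?_⟩
  obtain ⟨l, h1⟩ := Set.mem_iUnion.mp h1
  obtain ⟨l', h2⟩ := Set.mem_iUnion.mp h2
  rcases eq_or_ne l l' with rfl | hne
  · exact (h l).2 t₁ h1 t₂ h2 hlt g hg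
  · exact absurd hlt (hX l l' hne t₁ h1 t₂ h2)

end EssentiallyIncomparable

end Choices

/-! ### Tree analyses and restrictions of functionals in the norming set. -/

theorem SignType.cast_injective_real : Function.Injective (fun s : SignType => (s : ℝ)) := by
  intro s t h
  cases s <;> cases t <;> first | rfl | (norm_num at h)

/-- The functional `n ↦ ε n * f n`. -/
def mulSign (ε : ℕ+ → SignType) (f : ℕ+ →₀ ℝ) : ℕ+ →₀ ℝ :=
  Finsupp.onFinset f.support (fun n => (ε n : ℝ) * f n) fun _ h =>
    Finsupp.mem_support_iff.mpr (right_ne_zero_of_mul h)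

theorem mulSign_apply (ε : ℕ+ → SignType) (f : ℕ+ →₀ ℝ) (n : ℕ+) :
    mulSign ε f n = (ε n : ℝ) * f n := rfl

theorem mulSign_support_subset (ε : ℕ+ → SignType) (f : ℕ+ →₀ ℝ) :
    (mulSign ε f).support ⊆ f.support := Finsupp.support_onFinset_subset

theorem mulSign_half_sum (ε : ℕ+ → SignType) {k : ℕ} (f : Fin k → ℕ+ →₀ ℝ) :
    mulSign ε ((1 / 2 : ℝ) • ∑ i, f i) = (1 / 2 : ℝ) • ∑ i, mulSign ε (f i) := by
  ext n
  simp only [mulSign_apply, Finsupp.smul_apply, Finsupp.finsetSum_apply, smul_eq_mul,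
    Finset.mul_sum]
  exact Finset.sum_congr rfl fun i _ => by ring

theorem Admissible.mulSign {k : ℕ} {f : Fin k → ℕ+ →₀ ℝ} (h : Admissible f)
    (ε : ℕ+ → SignType) : Admissible fun i => mulSign ε (f i) :=
  ⟨fun i x hx => h.1 i x (mulSign_support_subset _ _ hx), fun i j hij x hx y hy =>
    h.2 i j hij x (mulSign_support_subset _ _ hx) y (mulSign_support_subset _ _ hy)⟩

theorem Admissible.half_sum_apply {k : ℕ} {f : Fin k → ℕ+ →₀ ℝ} (h : Admissible f) {i : Fin k}
    {n : ℕ+} (hn : n ∈ (f i).support) : ((1 / 2 : ℝ) • ∑ i, f i) n = 1 / 2 * f i n := by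
  rw [Finsupp.smul_apply, Finsupp.finsetSum_apply, smul_eq_mul, Finset.sum_eq_single i]
  · intro j _ hj
    by_contra hne
    have hne := Finsupp.mem_support_iff.mpr hne
    rcases lt_or_gt_of_ne hj with hlt | hlt
    · exact lt_irrefl _ (h.2 _ _ hlt n hne n hn)
    · exact lt_irrefl _ (h.2 _ _ hlt n hn n hne)
  · exact fun hi => absurd (Finset.mem_univ i) hi

theorem Admissible.support_subset {k : ℕ} {f : Fin k → ℕ+ →₀ ℝ} (h : Admissible f) (i : Fin k) :
    (f i).support ⊆ ((1 / 2 : ℝ) • ∑ i, f i).support := fun n hn => by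
  rw [Finsupp.mem_support_iff, h.half_sum_apply hn]
  exact mul_ne_zero (by norm_num) (Finsupp.mem_support_iff.mp hn)

/-- The supports are disjoint, so at most one `i` prescribes a value at each coordinate; elsewhere
the value `0` is irrelevant. -/
theorem Admissible.exists_glue {k : ℕ} {f : Fin k → ℕ+ →₀ ℝ} (h : Admissible f)
    (ω : Fin k → ℕ+ → ℕ) : ∃ ω' : ℕ+ → ℕ, ∀ i, ∀ n ∈ (f i).support, ω' n = ω i n := by
  have : ∀ n, ∃ j, ∀ i, n ∈ (f i).support → j = ω i n := by
    intro n
    by_cases hn : ∃ i, n ∈ (f i).support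
    · obtain ⟨i, hi⟩ := hn
      refine ⟨ω i n, fun i' hi' => ?_⟩
      rcases lt_trichotomy i i' with hlt | rfl | hlt
      · exact absurd (h.2 _ _ hlt n hi n hi') (lt_irrefl _)
      · rfl
      · exact absurd (h.2 _ _ hlt n hi' n hi) (lt_irrefl _)
    · exact ⟨0, fun i hi => absurd ⟨i, hi⟩ hn⟩
  choose ω' hω' using this
  exact ⟨ω', fun i n hn => hω' n i hn⟩

namespace Choices

variable {D : Choices}

theorem m_pos (j : ℕ) : (0 : ℝ) < D.m j := by
  have h0 : D.m 0 ≤ D.m j := D.m_mono.monotone (Nat.zero_le _)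
  rw [D.m_zero] at h0
  exact_mod_cast (by omega : 0 < D.m j)

theorem two_le_m (j : ℕ) : (2 : ℝ) ≤ D.m j := by
  have h0 : D.m 0 ≤ D.m j := D.m_mono.monotone (Nat.zero_le _)
  rw [D.m_zero] at h0
  exact_mod_cast h0

theorem weighted_apply (t : WPair) (n : ℕ+) :
    D.weighted t n = (D.m t.2 : ℝ)⁻¹ * (t.1 n : ℝ) := Finsupp.mapRange_apply ..

theorem weighted_support (t : WPair) : (D.weighted t).support = t.1.support := by
  ext n
  rw [Finsupp.mem_support_iff, Finsupp.mem_support_iff, weighted_apply]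
  have := (D.m_pos t.2).ne'
  cases t.1 n <;> simp [this]

theorem abs_weighted_apply {t : WPair} {n : ℕ+} (h : n ∈ t.1.support) :
    |D.weighted t n| = (D.m t.2 : ℝ)⁻¹ := by
  rw [weighted_apply, abs_mul, abs_inv, Nat.abs_cast]
  rw [Finsupp.mem_support_iff] at h
  have : |((t.1 n : SignType) : ℝ)| = 1 := by
    revert h
    cases t.1 n <;> simp
  rw [this, mul_one]

/-- The common absolute value `1 / m_j` on the support recovers the weight, and then the signs are
recovered. For `g = 0` the weight would be lost. -/
theorem weighted_inj {s t : WPair} (hs : s.1 ≠ 0) (h : D.weighted s = D.weighted t) : s = t := by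
  obtain ⟨n, hn⟩ := Finsupp.support_nonempty_iff.mpr hs
  have hn' : n ∈ t.1.support := by rwa [← weighted_support (D := D), ← h, weighted_support]
  have h1 := abs_weighted_apply (D := D) hn
  rw [h, abs_weighted_apply hn', inv_inj] at h1
  have h2 : t.2 = s.2 := D.m_mono.injective (by exact_mod_cast h1)
  refine Prod.ext (Finsupp.ext fun k => SignType.cast_injective_real ?_) h2.symm
  have h3 := DFunLike.congr_fun h k
  rw [weighted_apply, weighted_apply, h2] at h3
  exact mul_left_cancel₀ (inv_ne_zero (D.m_pos _).ne') h3

/-- All coefficients are at most `1 / 2` in absolute value, so a leaf in `G₁` is never a unit vector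
in disguise. -/
theorem weighted_notMem_G₀ (t : WPair) : D.weighted t ∉ G₀ := by
  rintro ⟨n, h⟩
  have h1 : |D.weighted t n| = 1 := by
    rcases h with h | h <;> rw [h] <;> simp
  have hn : n ∈ t.1.support := by
    rw [← weighted_support (D := D), Finsupp.mem_support_iff]
    rintro h0
    simp [h0] at h1
  rw [abs_weighted_apply hn, inv_eq_one] at h1
  linarith [D.two_le_m t.2]

variable (D) in
/-- The functionals with a tree analysis whose leaves of the form `m_j⁻¹ ∑ g(n) e_n^*` have their
pairs `(g, m_j)` in `X`. The function `ω` returns at every coordinate in the support the weight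
index `j` of the leaf acting there, and `0` for a leaf `± e_n^*`. -/
inductive Built (X : Set WPair) (ω : ℕ+ → ℕ) : (ℕ+ →₀ ℝ) → Prop
  | unit (n : ℕ+) (f : ℕ+ →₀ ℝ) (hf : f = Finsupp.single n 1 ∨ f = -Finsupp.single n 1)
      (hω : ω n = 0) : Built X ω f
  | weighted (t : WPair) (ht : t ∈ X) (hw : t ∈ D.weightedPairs)
      (hω : ∀ n ∈ t.1.support, ω n = t.2) : Built X ω (D.weighted t)
  | node (k : ℕ) (f : Fin k → (ℕ+ →₀ ℝ)) (hk : 0 < k) (hf : ∀ i, Built X ω (f i))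
      (ha : Admissible f) : Built X ω ((1 / 2 : ℝ) • ∑ i, f i)

theorem support_unit {n : ℕ+} {f : ℕ+ →₀ ℝ}
    (hf : f = Finsupp.single n 1 ∨ f = -Finsupp.single n 1) : f.support = {n} := by
  rcases hf with rfl | rfl <;> simp

namespace Built

variable {X Y : Set WPair} {ω ω' : ℕ+ → ℕ} {f : ℕ+ →₀ ℝ}

theorem mono (h : D.Built X ω f) (hXY : X ⊆ Y) : D.Built Y ω f := by
  induction h with
  | unit n f hf hω => exact unit n f hf hω
  | weighted t ht hw hω => exact weighted t (hXY ht) hw hω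
  | node k f hk _ ha ih => exact node k f hk ih ha

theorem congr (h : D.Built X ω f) (hω : ∀ n ∈ f.support, ω' n = ω n) : D.Built X ω' f := by
  induction h with
  | unit n f hf h0 => exact unit n f hf (by rw [hω n (by rw [support_unit hf]; simp), h0])
  | weighted t ht hw h0 =>
    rw [weighted_support] at hω
    exact weighted t ht hw fun n hn => by rw [hω n hn, h0 n hn]
  | node k f hk _ ha ih =>
    exact node k f hk (fun i => ih i fun n hn => hω n (ha.support_subset i hn)) ha

theorem exists_analysis (h : D.Built X ω f) : ∃ A : FTree, A.IsAnalysis D.ground ∧ A.value = f ∧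
    A.leaves ⊆ G₀ ∪ D.weighted '' X := by
  induction h with
  | unit n f hf _ =>
    exact ⟨.leaf f, Or.inl ⟨n, hf⟩, rfl, Set.singleton_subset_iff.mpr (Or.inl ⟨n, hf⟩)⟩
  | weighted t ht hw _ =>
    exact ⟨.leaf (D.weighted t), Or.inr ⟨t, hw, rfl⟩, rfl,
      Set.singleton_subset_iff.mpr (Or.inr ⟨t, ht, rfl⟩)⟩
  | node k f hk _ ha ih =>
    choose A h1 h2 h3 using ih
    exact ⟨.node k A, ⟨hk, h1, by simpa only [h2] using ha⟩, by simp only [FTree.value, h2],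
      Set.iUnion_subset h3⟩

end Built

theorem value_mem_tsirelsonExtension {A : FTree} {G : Set (ℕ+ →₀ ℝ)} (hA : A.IsAnalysis G) :
    A.value ∈ tsirelsonExtension G := by
  rintro V ⟨hG, hV⟩
  induction A with
  | leaf f => exact hG hA
  | node k c ih => exact hV k _ hA.1 (fun i => ih i (hA.2.1 i)) hA.2.2

/-- `leafPairs` collects every pair that could represent a leaf, so one needs that a leaf has no
representation other than the chosen one: elements of `G₀` have none, and nodes have nonzero `g`, to
which `weighted_inj` applies. -/
theorem Built.mem_W {X : Set WPair} {ω : ℕ+ → ℕ} {f : ℕ+ →₀ ℝ} (h : D.Built X ω f)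
    (hX : D.EssentiallyIncomparable X) : f ∈ D.W := by
  obtain ⟨A, h1, rfl, h3⟩ := h.exists_analysis
  refine ⟨value_mem_tsirelsonExtension h1, A, h1, rfl, hX.refine fun t ht => ?_⟩
  rcases h3 ht.2 with h | ⟨s, hs, hst⟩
  · exact absurd h (weighted_notMem_G₀ t)
  · obtain ⟨L, hL⟩ := mem_nodes_iff.mp (hX.1 hs)
    have hs0 : s.1 ≠ 0 := hL.2.1 s (by simp)
    obtain rfl := weighted_inj hs0 hst
    exact ⟨s, hs, rfl, hs0, subset_rfl⟩

theorem exists_built_of_isAnalysis {A : FTree} (hA : A.IsAnalysis D.ground) :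
    ∃ ω, D.Built (D.leafPairs A) ω A.value := by
  classical
  induction A with
  | leaf f =>
    rcases hA with ⟨n, hf⟩ | ⟨t, ht, rfl⟩
    · exact ⟨fun _ => 0, .unit n f hf rfl⟩
    · exact ⟨fun _ => t.2, .weighted t ⟨ht, rfl⟩ ht fun _ _ => rfl⟩
  | node k c ih =>
    choose ω hω using fun i => ih i (hA.2.1 i)
    obtain ⟨ω', hω'⟩ := hA.2.2.exists_glue ω
    refine ⟨ω', .node k _ hA.1 (fun i => ((hω i).congr fun n hn => hω' i n hn).mono ?_)
      hA.2.2⟩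
    exact fun t ht => ⟨ht.1, Set.mem_iUnion.mpr ⟨i, ht.2⟩⟩

theorem mem_W_iff {f : ℕ+ →₀ ℝ} :
    f ∈ D.W ↔ ∃ X ω, D.EssentiallyIncomparable X ∧ D.Built X ω f := by
  constructor
  · rintro ⟨-, A, hA, rfl, hX⟩
    obtain ⟨ω, h⟩ := exists_built_of_isAnalysis hA
    exact ⟨_, ω, hX, h⟩
  · rintro ⟨X, ω, hX, h⟩
    exact h.mem_W hX

/-- Dropping the zero summands lowers `k`, which only weakens `k ≤ supp f_i`. -/
theorem Built.half_sum {X : Set WPair} {ω : ℕ+ → ℕ} {k : ℕ} {f : Fin k → ℕ+ →₀ ℝ}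
    (ha : Admissible f) (hf : ∀ i, f i = 0 ∨ D.Built X ω (f i)) :
    (1 / 2 : ℝ) • ∑ i, f i = 0 ∨ D.Built X ω ((1 / 2 : ℝ) • ∑ i, f i) := by
  classical
  let s : Finset (Fin k) := Finset.univ.filter fun i => f i ≠ 0
  let e := s.orderEmbOfFin rfl
  have hsum : ∑ i, f i = ∑ i, f (e i) := by
    rw [← Finset.sum_filter_ne_zero]
    have : s = Finset.univ.map e.toEmbedding := by
      ext i
      simp only [Finset.mem_map, Finset.mem_univ, true_and]
      exact (Set.ext_iff.mp (s.range_orderEmbOfFin rfl) i).symm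
    change ∑ i ∈ s, f i = _
    conv_lhs => rw [this]
    rw [Finset.sum_map]
    rfl
  rcases Nat.eq_zero_or_pos s.card with h0 | hpos
  · left
    have : ∀ i, f i = 0 := by
      intro i
      by_contra hi
      have : i ∈ s := Finset.mem_filter.mpr ⟨Finset.mem_univ _, hi⟩
      rw [Finset.card_eq_zero.mp h0] at this
      exact absurd this (Finset.notMem_empty _)
    simp [this]
  · right
    rw [hsum]
    refine .node _ _ hpos (fun i => (hf _).resolve_left ?_) ⟨fun i x hx => ?_, fun i j hij => ?_⟩
    · exact (Finset.mem_filter.mp (s.orderEmbOfFin_mem rfl i)).2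
    · refine le_trans ?_ (ha.1 _ x hx)
      simpa using s.card_le_univ
    · exact ha.2 _ _ (e.strictMono hij)

/-- Multiplying by signs and zeros acts leaf by leaf: unit leaves survive up to sign or vanish,
weighted leaves are refined. A surviving weighted leaf has a coordinate with `ε n ≠ 0`, which puts
its weight in `Q`. -/
theorem Built.restrict {X : Set WPair} {ω : ℕ+ → ℕ} {f : ℕ+ →₀ ℝ} (h : D.Built X ω f)
    (ε : ℕ+ → SignType) {Q : Set ℕ} (hQ : ∀ n, ε n ≠ 0 → ω n ∈ Q) :
    mulSign ε f = 0 ∨ D.Built {t' | (∃ t ∈ X, Refines t' t) ∧ t'.2 ∈ Q} ω (mulSign ε f) := by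
  classical
  induction h with
  | unit n f hf hω =>
    have key : mulSign ε f = (ε n : ℝ) • f := by
      ext k
      rw [mulSign_apply, Finsupp.smul_apply, smul_eq_mul]
      by_cases hk : k = n
      · rw [hk]
      · have : f k = 0 := by
          rw [← Finsupp.notMem_support_iff, support_unit hf]; simpa using hk
        rw [this, mul_zero, mul_zero]
    rw [key]
    cases hε : ε n
    · simp
    · right
      refine .unit n _ ?_ hω
      rcases hf with rfl | rfl
      · right; simp
      · left; simp
    · right
      refine .unit n _ ?_ hω
      rcases hf with rfl | rfl
      · left; simp
      · right; simp
  | weighted t ht hw hω =>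
    let g : SignFn := Finsupp.onFinset t.1.support (fun n => ε n * t.1 n) fun n h =>
      Finsupp.mem_support_iff.mpr (right_ne_zero_of_mul h)
    have hgs : g.support ⊆ t.1.support := Finsupp.support_onFinset_subset
    have key : EssInc.mulSign ε (D.weighted t) = D.weighted (g, t.2) := by
      ext n
      rw [mulSign_apply, weighted_apply, weighted_apply]
      change _ = (D.m t.2 : ℝ)⁻¹ * ((ε n * t.1 n : SignType) : ℝ)
      cases ε n <;> cases t.1 n <;> simp
    rw [key]
    rcases eq_or_ne g 0 with h0 | h0
    · left
      rw [← Finsupp.support_eq_empty, weighted_support, h0]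
      rfl
    · right
      obtain ⟨n, hn⟩ := Finsupp.support_nonempty_iff.mpr h0
      refine .weighted _ ⟨⟨t, ht, rfl, h0, hgs⟩, ?_⟩
        ⟨hw.1, schreier_subset D.a hw.2 hgs⟩ fun n hn => hω n (hgs hn)
      rw [← hω n (hgs hn)]
      exact hQ n (left_ne_zero_of_mul (Finsupp.mem_support_iff.mp hn))
  | node k f hk _ ha ih =>
    rw [mulSign_half_sum]
    exact Built.half_sum (ha.mulSign ε) ih

theorem mem_W_mulSign {f : ℕ+ →₀ ℝ} (hf : f ∈ D.W) (ε : ℕ+ → SignType) :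
    mulSign ε f = 0 ∨ mulSign ε f ∈ D.W := by
  obtain ⟨X, ω, hX, h⟩ := mem_W_iff.mp hf
  refine (h.restrict ε (Q := Set.univ) fun _ _ => trivial).imp_right fun h => h.mem_W ?_
  exact hX.refine fun t ht => ht.1

theorem abs_pairing_le {f : ℕ+ →₀ ℝ} (hf : f = 0 ∨ f ∈ D.W) (x : ℕ+ →₀ ℝ) :
    |pairing f x| ≤ D.normW x := by
  rcases hf with rfl | hf
  · simp only [pairing, Finsupp.coe_zero, Pi.zero_apply, zero_mul, Finset.sum_const_zero, abs_zero]
    exact Real.iSup_nonneg fun _ => abs_nonneg _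
  · exact le_ciSup (D.bddAbove_normW x) ⟨f, hf⟩

end Choices

/-! ### Blocks with incomparable weights, and unbounded sums. -/

open Filter in
/-- Given uniformly large finitely additive masses on `ℕ` and a well-founded tree order `T` on `ℕ`,
infinitely many of the masses can be restricted to pairwise incomparable sets without becoming
small. -/
theorem exists_incomparable_of_mass {ν : ℕ → Set ℕ → ℝ} {Ω : ℕ → Set ℕ} {T : ℕ → ℕ → Prop} {δ : ℝ}
    (hΩ : ∀ i, (Ω i).Finite) (hmono : ∀ i P Q, P ⊆ Q → ν i P ≤ ν i Q) (hempty : ∀ i, ν i ∅ = 0)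
    (hunion : ∀ i P Q, ν i (P ∪ Q) ≤ ν i P + ν i Q) (hsupp : ∀ i P, ν i P ≤ ν i (P ∩ Ω i))
    (hδ : 0 < δ) (hν : ∀ i, δ ≤ ν i Set.univ) (hT : ∀ i j, T i j → i < j)
    (wf : WellFounded fun i j => T j i) :
    ∃ ε > 0, ∃ I : ℕ → ℕ, StrictMono I ∧ ∃ Q : ℕ → Set ℕ, (∀ l, ε ≤ ν (I l) (Q l)) ∧
      ∀ l l', l ≠ l' → ∀ w ∈ Q l, ∀ w' ∈ Q l', ¬ T w w' := by
  classical
  let U : Filter ℕ := (hyperfilter ℕ : Filter ℕ)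
  have hU : U ≤ atTop := Nat.cofinite_eq_atTop ▸ hyperfilter_le_cofinite
  -- Null sets are those whose mass tends to `0` along a free ultrafilter. They form an ideal, and a
  -- set that is not null has mass bounded below for almost all `i`.
  let Null : Set ℕ → Prop := fun P => ∀ ε > 0, ∀ᶠ i in U, ν i P < ε
  have not_null : ∀ {P}, ¬ Null P → ∃ ε > 0, ∀ᶠ i in U, ε ≤ ν i P := by
    intro P hP
    simp only [Null, not_forall] at hP
    obtain ⟨ε, hε, h⟩ := hP
    refine ⟨ε, hε, ?_⟩
    filter_upwards [Ultrafilter.eventually_not.mpr h] with i hi using not_lt.mp hi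
  have null_union : ∀ {P Q}, Null P → Null Q → Null (P ∪ Q) := by
    intro P Q hP hQ ε hε
    filter_upwards [hP (ε / 2) (by positivity), hQ (ε / 2) (by positivity)] with i h1 h2
    linarith [hunion i P Q]
  have null_biUnion : ∀ {ι : Type} {s : Set ι} (_ : s.Finite) {P : ι → Set ℕ},
      (∀ x ∈ s, Null (P x)) → Null (⋃ x ∈ s, P x) := by
    intro ι s hs P hP
    induction s, hs using Set.Finite.induction_on with
    | empty => intro ε hε; simp [hempty, hε]
    | insert _ _ ih =>
      rw [Set.biUnion_insert]
      exact null_union (hP _ (Set.mem_insert _ _))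
        (ih fun x hx => hP x (Set.mem_insert_of_mem _ hx))
  by_cases hsing : ∃ w, ¬ Null {w}
  · obtain ⟨w, hw⟩ := hsing
    obtain ⟨ε, hε, h⟩ := not_null hw
    obtain ⟨I, hI, h⟩ := extraction_of_frequently_atTop (h.frequently.filter_mono hU)
    refine ⟨ε, hε, I, hI, fun _ => {w}, h, ?_⟩
    rintro l l' - _ rfl _ rfl h
    exact lt_irrefl _ (hT _ _ h)
  push Not at hsing
  -- Take a maximal `w` whose set of successors is not null, and let `P` be that set; if there is no
  -- such `w`, all of `ℕ` serves.
  obtain ⟨P, hP, hPD⟩ : ∃ P, ¬ Null P ∧ ∀ w ∈ P, Null {v | T w v} := by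
    by_cases h : ∃ w, ¬ Null {v | T w v}
    · obtain ⟨w, hw, hmin⟩ := wf.has_min {w | ¬ Null {v | T w v}} h
      exact ⟨_, hw, fun v hv => not_not.mp fun hn => hmin v hn hv⟩
    · push Not at h
      refine ⟨Set.univ, fun hn => ?_, fun w _ => h w⟩
      obtain ⟨i, hi⟩ := (hn δ hδ).exists
      exact hi.not_ge (hν i)
  obtain ⟨ε, hε, hεP⟩ := not_null hP
  obtain ⟨q, hq1, hq2⟩ := exists_seq_of_forall_finset_exists
    (fun p : ℕ × Set ℕ => ε / 2 ≤ ν p.1 p.2 ∧ p.2.Finite ∧ p.2 ⊆ P)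
    (fun p q => p.1 < q.1 ∧ ∀ w ∈ p.2, ∀ w' ∈ q.2, ¬ T w w' ∧ ¬ T w' w) (by
      intro s hs
      -- The new set must avoid all weights comparable to earlier ones. Successors form null sets by
      -- the choice of `P`; predecessors are among the finitely many `v ≤ w`, and points are null.
      let B : Set ℕ := ⋃ p ∈ (s : Set (ℕ × Set ℕ)), ⋃ w ∈ p.2, ({v | T w v} ∪ ⋃ v ∈ Set.Iic w, {v})
      have hB : Null B := null_biUnion s.finite_toSet fun p hp =>
        null_biUnion (hs p hp).2.1 fun w hw =>
          null_union (hPD w ((hs p hp).2.2 hw)) (null_biUnion (Set.finite_Iic w) fun v _ => hsing v)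
      have hlarge : ∀ᶠ i in U, ∀ p ∈ s, p.1 < i :=
        (Finset.eventually_all s).mpr fun p _ => hU (eventually_gt_atTop p.1)
      obtain ⟨i, ⟨h1, h2⟩, h3⟩ := ((hεP.and (hB (ε / 2) (by positivity))).and hlarge).exists
      refine ⟨(i, (P \ B) ∩ Ω i), ⟨?_, (hΩ i).subset Set.inter_subset_right,
        Set.inter_subset_left.trans Set.sdiff_subset⟩, fun p hp => ⟨h3 p hp, ?_⟩⟩
      · have h4 := hunion i (P \ B) B
        have h5 := hmono i P (P \ B ∪ B) (by rw [Set.sdiff_union_self]; exact Set.subset_union_left)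
        have h6 := hsupp i (P \ B)
        dsimp only
        linarith
      · rintro w hw w' ⟨⟨-, hw'⟩, -⟩
        refine ⟨fun h => hw' ?_, fun h => hw' ?_⟩
        · exact Set.mem_biUnion hp (Set.mem_biUnion hw (Or.inl h))
        · exact Set.mem_biUnion hp (Set.mem_biUnion hw
            (Or.inr (Set.mem_biUnion (Set.mem_Iic.mpr (hT _ _ h).le) rfl))))
  refine ⟨ε / 2, by positivity, fun l => (q l).1, fun l l' h => (hq2 l l' h).1, fun l => (q l).2,
    fun l => (hq1 l).1, fun l l' hne w hw w' hw' => ?_⟩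
  rcases lt_or_gt_of_ne hne with h | h
  · exact ((hq2 _ _ h).2 w hw w' hw').1
  · exact ((hq2 _ _ h).2 w' hw' w hw).2

theorem pairing_sum (f : ℕ+ →₀ ℝ) {ι : Type*} (s : Finset ι) (x : ι → ℕ+ →₀ ℝ) :
    pairing f (∑ i ∈ s, x i) = ∑ i ∈ s, pairing f (x i) := by
  classical
  induction s using Finset.induction_on with
  | empty => simp [pairing]
  | insert i s hi ih => rw [Finset.sum_insert hi, Finset.sum_insert hi, pairing_add, ih]

namespace Choices

variable {D : Choices}

theorem normW_zero : D.normW 0 = 0 := map_zero D.seminormW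

/-- A vector is almost normed by a functional acting positively on it inside its support. -/
theorem exists_built_norming {x : ℕ+ →₀ ℝ} {δ : ℝ} (hδ : 0 < δ) (hx : δ < D.normW x) :
    ∃ X ω f, D.EssentiallyIncomparable X ∧ D.Built X ω f ∧ f.support ⊆ x.support ∧
      (∀ n, 0 ≤ f n * x n) ∧ δ ≤ pairing f x := by
  have : ∃ f ∈ D.W, δ < |pairing f x| := by
    by_contra! h
    exact hx.not_ge (Real.iSup_le (fun f => h f.1 f.2) hδ.le)
  obtain ⟨f, hf, hfx⟩ := this
  -- These signs turn each term into `|f n * x n|` and erase `f` off the support of `x`.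
  let ε : ℕ+ → SignType := fun n => SignType.sign (f n * x n)
  have habs : ∀ n, mulSign ε f n * x n = |f n * x n| := fun n => by
    rw [mulSign_apply, mul_assoc, sign_mul_self]
  have hge : δ ≤ pairing (mulSign ε f) x := by
    refine hfx.le.trans ((Finset.abs_sum_le_sum_abs _ _).trans_eq ?_)
    exact Finset.sum_congr rfl fun n _ => (habs n).symm
  have hW := (mem_W_mulSign hf ε).resolve_left fun h0 => by
    rw [h0] at hge
    simp [pairing] at hge
    linarith
  obtain ⟨X, ω, hX, hb⟩ := mem_W_iff.mp hW
  refine ⟨X, ω, _, hX, hb, fun n hn => ?_, fun n => by rw [habs]; exact abs_nonneg _, hge⟩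
  rw [Finsupp.mem_support_iff] at hn ⊢
  intro h0
  simp [mulSign_apply, ε, h0] at hn

/-- Semi-normalized block sequences do not have bounded sums. -/
theorem exists_lt_normW_sum {x : ℕ → ℕ+ →₀ ℝ}
    (hx : ∀ i j, i < j → Before (x i).support (x j).support) {δ : ℝ} (hδ : 0 < δ)
    (hn : ∀ i, δ < D.normW (x i)) (C : ℝ) : ∃ F : Finset ℕ, C < D.normW (∑ i ∈ F, x i) := by
  classical
  choose X ω f hX hb hs hpos hge using fun i => exists_built_norming hδ (hn i)
  have hx0 : ∀ i, (x i).support.Nonempty := fun i => by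
    rw [Finsupp.support_nonempty_iff]
    rintro h0
    have := hn i
    rw [h0, normW_zero] at this
    linarith
  have hfar : ∀ i, ∀ n ∈ (x i).support, i ≤ (n : ℕ) := by
    intro i
    induction i with
    | zero => exact fun _ _ => Nat.zero_le _
    | succ i ih =>
      intro n hn
      obtain ⟨k, hk⟩ := hx0 i
      have h1 := ih k hk
      have h2 : (k : ℕ) < n := hx i (i + 1) (Nat.lt_succ_self i) k hk n hn
      omega
  -- The part of `f_i(x_i)` contributed by leaves with weight index in `P`; unit leaves count under
  -- index `0`.
  let ν : ℕ → Set ℕ → ℝ := fun i P => ∑ n ∈ (x i).support with ω i n ∈ P, f i n * x i n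
  obtain ⟨ε, hε, I, hI, Q, hQ, hinc⟩ := exists_incomparable_of_mass (ν := ν)
    (Ω := fun i => ω i '' (x i).support) (T := D.WeightLT)
    (fun i => (x i).support.finite_toSet.image _)
    (fun i P P' h => Finset.sum_le_sum_of_subset_of_nonneg
      (Finset.monotone_filter_right _ fun n _ hn => h hn) fun n _ _ => hpos i n)
    (fun i => by simp [ν])
    (fun i P P' => by
      simp only [ν, Finset.sum_filter, ← Finset.sum_add_distrib]
      refine Finset.sum_le_sum fun n _ => ?_
      have := hpos i n
      by_cases h1 : ω i n ∈ P <;> by_cases h2 : ω i n ∈ P' <;> simp [h1, h2, this])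
    (fun i P => by
      simp only [ν, Finset.sum_filter]
      refine Finset.sum_le_sum fun n hn => ?_
      by_cases h : ω i n ∈ P
      · rw [if_pos h, if_pos ⟨h, n, hn, rfl⟩]
      · rw [if_neg h, if_neg fun h' => h h'.1])
    hδ (fun i => by simpa [ν, pairing] using hge i) (fun _ _ h => h.lt) wellFounded_weightLT
  obtain ⟨N, hN⟩ := exists_nat_gt (max (C / (ε / 2)) 0)
  have hN0 : 0 < N := by exact_mod_cast (le_max_right _ _).trans_lt hN
  have hNC : C < N * (1 / 2 * ε) := by
    have := (div_lt_iff₀ (by positivity)).mp ((le_max_left _ _).trans_lt hN)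
    linarith
  -- The shift by `N` places all `N` blocks beyond `N`, as admissibility demands.
  let J : Fin N → ℕ := fun l => I (N + l)
  have hJ : StrictMono J := fun l l' h => hI (by simpa using h)
  let η : Fin N → ℕ+ → SignType := fun l n => if ω (J l) n ∈ Q (N + l) then 1 else 0
  let h : Fin N → ℕ+ →₀ ℝ := fun l => mulSign (η l) (f (J l))
  have hpair : ∀ l, ε ≤ ∑ n ∈ (x (J l)).support, h l n * x (J l) n := by
    intro l
    refine (hQ (N + l)).trans_eq ?_
    simp only [ν, Finset.sum_filter]
    refine Finset.sum_congr rfl fun n _ => ?_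
    simp only [h, mulSign_apply, η, J]
    split_ifs <;> simp
  have hsup : ∀ l, (h l).support ⊆ (x (J l)).support := fun l =>
    (mulSign_support_subset _ _).trans (hs _)
  have hadm : Admissible h :=
    ⟨fun l n hn => ((Nat.le_add_right N l).trans hI.le_apply).trans (hfar _ n (hsup l hn)),
      fun l l' hll n hn n' hn' => hx _ _ (hJ hll) n (hsup l hn) n' (hsup l' hn')⟩
  let Y : Fin N → Set WPair := fun l =>
    {t' | (∃ t ∈ X (J l), Refines t' t) ∧ t'.2 ∈ Q (N + l)}
  have hY : D.EssentiallyIncomparable (⋃ l, Y l) :=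
    EssentiallyIncomparable.iUnion (fun l => (hX (J l)).refine fun t ht => ht.1)
      fun l l' hne t ht t' ht' => hinc _ _ (by simpa [Fin.ext_iff] using hne) _ ht.2 _ ht'.2
  obtain ⟨ω', hω'⟩ := hadm.exists_glue fun l => ω (J l)
  have hF := Built.half_sum (D := D) (X := ⋃ l, Y l) (ω := ω') hadm fun l =>
    ((hb (J l)).restrict (η l) (Q := Q (N + l)) (fun n hn => by
      by_contra hc
      simp [η, hc] at hn)).imp_right
      fun hB => (hB.congr (hω' l)).mono (Set.subset_iUnion Y l)
  refine ⟨Finset.univ.map ⟨J, hJ.injective⟩, hNC.trans_le ?_⟩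
  rw [Finset.sum_map]
  refine le_trans ?_ (abs_pairing_le (hF.imp_right fun h => h.mem_W hY) _)
  refine le_trans ?_ (le_abs_self _)
  rw [pairing_sum]
  have hterm : ∀ l ∈ (Finset.univ : Finset (Fin N)),
      1 / 2 * ε ≤ pairing ((1 / 2 : ℝ) • ∑ l, h l) (x (J l)) := by
    intro l _
    refine (mul_le_mul_of_nonneg_left (hpair l) (by norm_num)).trans_eq ?_
    rw [Finset.mul_sum, pairing]
    refine Finset.sum_congr rfl fun n hn => ?_
    rw [Finsupp.smul_apply, Finsupp.finsetSum_apply, smul_eq_mul, Finset.sum_eq_single l, mul_assoc]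
    · intro l' _ hne
      by_contra h0
      have h0 := hsup l' (Finsupp.mem_support_iff.mpr h0)
      rcases lt_or_gt_of_ne hne with hlt | hlt
      · exact lt_irrefl _ (hx _ _ (hJ hlt) n h0 n hn)
      · exact lt_irrefl _ (hx _ _ (hJ hlt) n hn n h0)
    · exact fun hl => absurd (Finset.mem_univ l) hl
  have := Finset.card_nsmul_le_sum _ _ _ hterm
  simpa using this

end Choices

/-! ### Pointwise limits of the norming set. -/

open Filter Topology

namespace Choices

variable (D : Choices)

/-- The closure of the norming set (with `0`) for the topology of pointwise convergence. -/
def closureW : Set (ℕ+ → ℝ) := closure ((fun f : ℕ+ →₀ ℝ => (f : ℕ+ → ℝ)) '' insert 0 D.W)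

theorem isCompact_closureW : IsCompact D.closureW := by
  refine (isCompact_univ_pi fun _ : ℕ+ => isCompact_Icc (a := (-1 : ℝ)) (b := 1)).of_isClosed_subset
    isClosed_closure (closure_minimal ?_ (isCompact_univ_pi fun _ => isCompact_Icc).isClosed)
  rintro _ ⟨f, rfl | hf, rfl⟩ i -
  · simp
  · exact abs_le.mp (D.abs_apply_le hf i)

variable {D}

theorem coe_mem_closureW {f : ℕ+ →₀ ℝ} (hf : f = 0 ∨ f ∈ D.W) : (f : ℕ+ → ℝ) ∈ D.closureW :=
  subset_closure ⟨f, hf, rfl⟩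

/-- Each finite part of the support of a limit lies in the support of some approximant, hence in
`𝓢_{n_j}`; compactness of this family applies. -/
theorem finite_support_of_mem_closure_weighted (j : ℕ) {F : ℕ+ → ℝ}
    (hF : F ∈ closure {G : ℕ+ → ℝ | ∃ t ∈ D.weightedPairs, t.2 = j ∧ G = D.weighted t}) :
    {n | F n ≠ 0}.Finite := by
  refine finite_of_forall_mem_schreier D.a (D.n j) _ fun A hA => ?_
  have hopen : IsOpen (⋂ n ∈ A, {G : ℕ+ → ℝ | G n ≠ 0}) :=
    isOpen_biInter_finset fun n _ => isOpen_ne_fun (continuous_apply n) continuous_const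
  obtain ⟨G, hG, t, ht, rfl, rfl⟩ := mem_closure_iff.mp hF _ hopen
    (Set.mem_iInter₂.mpr fun n hn => hA hn)
  refine schreier_subset D.a ht.2 fun n hn => ?_
  rw [← weighted_support (D := D), Finsupp.mem_support_iff]
  exact Set.mem_iInter₂.mp hG n hn

variable (D) in
/-- Half sums of `k` successive elements of the closure of the norming set. -/
def halfSums (k : ℕ) : Set (ℕ+ → ℝ) :=
  (fun F : Fin k → ℕ+ → ℝ => (1 / 2 : ℝ) • ∑ i, F i) ''
    ((Set.univ.pi fun _ => D.closureW) ∩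
      {F | ∀ i j, i < j → ∀ n m, m ≤ n → F i n * F j m = 0})

/-- Expressing successive supports by vanishing products makes the condition closed, so this is a
continuous image of a compact set. -/
theorem isClosed_halfSums (k : ℕ) : IsClosed (D.halfSums k) := by
  refine IsCompact.isClosed (IsCompact.image ?_ (by fun_prop))
  refine (isCompact_univ_pi fun _ => D.isCompact_closureW).inter_right ?_
  simp only [Set.ofPred_forall]
  refine isClosed_iInter fun i => isClosed_iInter fun j => isClosed_iInter fun _ =>
    isClosed_iInter fun n => isClosed_iInter fun m => isClosed_iInter fun _ => ?_
  exact isClosed_eq (by fun_prop) continuous_const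

/-- A pointwise limit of the norming set is finitely supported, or up to a finite set it is half
of another such limit. -/
theorem finite_or_eventually_half {F : ℕ+ → ℝ} (hF : F ∈ D.closureW) :
    {n | F n ≠ 0}.Finite ∨ ∃ G ∈ D.closureW, {n | F n ≠ 1 / 2 * G n}.Finite := by
  by_cases h0 : ∀ n, F n = 0
  · simp [h0]
  push Not at h0
  obtain ⟨n₀, hn₀⟩ := h0
  let c := |F n₀| / 2
  have hc : 0 < c := half_pos (abs_pos.mpr hn₀)
  obtain ⟨J, hJ⟩ := exists_nat_gt c⁻¹
  have hV : IsOpen {G : ℕ+ → ℝ | c < |G n₀|} := isOpen_lt continuous_const (by fun_prop)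
  have h1 := hV.inter_closure ⟨show c < |F n₀| from half_lt_self (abs_pos.mpr hn₀), hF⟩
  -- Near `F` only finitely many kinds of functionals occur: unit vectors at `n₀`, weighted ones
  -- with `1 / m_j > c`, and half sums of `k ≤ n₀` terms. So `F` lies in the closure of a single
  -- kind.
  have h2 : {G : ℕ+ → ℝ | c < |G n₀|} ∩ (fun f : ℕ+ →₀ ℝ => (f : ℕ+ → ℝ)) '' insert 0 D.W ⊆
      ({G | ∀ n ≠ n₀, G n = 0} ∪
        ⋃ j ∈ Set.Iio J, {G : ℕ+ → ℝ | ∃ t ∈ D.weightedPairs, t.2 = j ∧ G = D.weighted t}) ∪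
        ⋃ k ∈ Set.Iic (n₀ : ℕ), D.halfSums k := by
    rintro _ ⟨hlt, f, hf, rfl⟩
    have hfn : f n₀ ≠ 0 := by
      have : c < |f n₀| := hlt
      exact abs_pos.mp (hc.trans this)
    have hf : f ∈ D.W := hf.resolve_left fun h => hfn (by rw [h]; rfl)
    obtain ⟨X, ω, hX, hb⟩ := mem_W_iff.mp hf
    cases hb with
    | unit n f hf _ =>
      refine Or.inl (Or.inl fun k hk => ?_)
      have hs := support_unit hf
      have h1 : n₀ ∈ f.support := Finsupp.mem_support_iff.mpr hfn
      rw [hs, Finset.mem_singleton] at h1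
      rw [← Finsupp.notMem_support_iff, hs, Finset.mem_singleton, ← h1]
      exact hk
    | weighted t ht hw _ =>
      refine Or.inl (Or.inr (Set.mem_biUnion (x := t.2) (Set.mem_Iio.mpr ?_) ⟨t, hw, rfl, rfl⟩))
      have h3 : n₀ ∈ t.1.support := by
        rw [← weighted_support (D := D)]; exact Finsupp.mem_support_iff.mpr hfn
      have h4 : c < (D.m t.2 : ℝ)⁻¹ := by rw [← abs_weighted_apply h3]; exact hlt
      have h5 : (D.m t.2 : ℝ) < J := ((lt_inv_comm₀ hc (m_pos _)).mp h4).trans hJ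
      exact lt_of_le_of_lt D.m_mono.le_apply (by exact_mod_cast h5)
    | node k f hk hb ha =>
      refine Or.inr (Set.mem_biUnion (x := k) ?_ ⟨fun i => f i, ⟨fun i _ =>
        coe_mem_closureW (Or.inr ((hb i).mem_W hX)), ?_⟩, ?_⟩)
      · have : ∃ i, n₀ ∈ (f i).support := by
          by_contra! h
          refine hfn ?_
          rw [Finsupp.smul_apply, Finsupp.finsetSum_apply, Finset.sum_eq_zero, smul_zero]
          exact fun i _ => Finsupp.notMem_support_iff.mp (h i)
        obtain ⟨i, hi⟩ := this
        exact ha.1 i n₀ hi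
      · intro i j hij n m hmn
        by_contra hne
        exact hmn.not_gt (ha.2 i j hij n (Finsupp.mem_support_iff.mpr (left_ne_zero_of_mul hne)) m
          (Finsupp.mem_support_iff.mpr (right_ne_zero_of_mul hne)))
      · ext n
        simp
  have h3 := closure_mono h2 h1
  rw [closure_union, closure_union, (Set.finite_Iio J).closure_biUnion,
    (Set.finite_Iic _).closure_biUnion] at h3
  rcases h3 with (h3 | h3) | h3
  · left
    have hcl : IsClosed {G : ℕ+ → ℝ | ∀ n ≠ n₀, G n = 0} := by
      simp only [Set.ofPred_forall]
      exact isClosed_iInter fun n => isClosed_iInter fun _ =>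
        isClosed_eq (continuous_apply n) continuous_const
    rw [hcl.closure_eq] at h3
    refine (Set.finite_singleton n₀).subset fun n hn => ?_
    by_contra hne
    exact hn (h3 n hne)
  · obtain ⟨j, -, h3⟩ := Set.mem_iUnion₂.mp h3
    exact Or.inl (finite_support_of_mem_closure_weighted j h3)
  · obtain ⟨k, -, h3⟩ := Set.mem_iUnion₂.mp h3
    rw [(isClosed_halfSums k).closure_eq] at h3
    obtain ⟨G, ⟨hG, hs⟩, rfl⟩ := h3
    by_cases hfin : ∀ i, {n | G i n ≠ 0}.Finite
    · left
      refine (Set.finite_iUnion hfin).subset fun n hn => ?_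
      by_contra hne
      simp only [Set.mem_iUnion, not_exists, Set.mem_ofPred_eq, not_not] at hne
      refine hn ?_
      simp [hne]
    · push Not at hfin
      obtain ⟨l, hl⟩ := hfin
      right
      refine ⟨G l, hG l trivial, ?_⟩
      -- Once `G l` has infinite support, terms before it are bounded by any point of that support
      -- and terms after it must vanish.
      have hfin : ∀ i, i ≠ l → {n | G i n ≠ 0}.Finite := by
        intro i hi
        rcases lt_or_gt_of_ne hi with h | h
        · obtain ⟨m, hm⟩ := hl.nonempty
          refine (Set.finite_Iio m).subset fun n hn => ?_
          by_contra hmn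
          exact mul_ne_zero hn hm (hs i l h n m (not_lt.mp hmn))
        · refine Set.finite_empty.subset fun m hm => ?_
          obtain ⟨n, hn, hmn⟩ := hl.exists_gt m
          exact mul_ne_zero hn hm (hs l i h n m hmn.le)
      refine (Set.finite_iUnion fun i : {i // i ≠ l} => hfin i i.2).subset fun n hn => ?_
      by_contra hne
      simp only [Set.mem_iUnion, not_exists, Set.mem_ofPred_eq, not_not] at hne
      refine hn ?_
      simp only [Pi.smul_apply, Finset.sum_apply, smul_eq_mul]
      rw [Finset.sum_eq_single l (fun i _ hi => hne ⟨i, hi⟩) (fun h => absurd (Finset.mem_univ l) h)]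

/-- The action of a function on a finitely supported vector. -/
def evalAt (x : ℕ+ →₀ ℝ) (F : ℕ+ → ℝ) : ℝ := ∑ n ∈ x.support, F n * x n

theorem continuous_evalAt (x : ℕ+ →₀ ℝ) : Continuous (evalAt x) := by
  unfold evalAt
  fun_prop

theorem abs_evalAt_le (x : ℕ+ →₀ ℝ) {F : ℕ+ → ℝ} (hF : F ∈ D.closureW) :
    |evalAt x F| ≤ D.normW x := by
  have hcl : IsClosed {F : ℕ+ → ℝ | |evalAt x F| ≤ D.normW x} :=
    isClosed_le (continuous_evalAt x).abs continuous_const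
  refine closure_minimal ?_ hcl hF
  rintro _ ⟨f, hf, rfl⟩
  exact abs_pairing_le hf x

/-- Every pointwise limit of the norming set is small on vectors supported far out. -/
theorem exists_abs_evalAt_le (k : ℕ) {F : ℕ+ → ℝ} (hF : F ∈ D.closureW) :
    ∃ N : ℕ+, ∀ x : ℕ+ →₀ ℝ, (∀ n ∈ x.support, N ≤ n) →
      |evalAt x F| ≤ (1 / 2) ^ k * D.normW x := by
  induction k generalizing F with
  | zero => exact ⟨1, fun x _ => by simpa using abs_evalAt_le x hF⟩
  | succ k ih =>
    rcases finite_or_eventually_half hF with h | ⟨G, hG, h⟩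
    · obtain ⟨N, hN⟩ := h.bddAbove
      refine ⟨N + 1, fun x hx => ?_⟩
      have : evalAt x F = 0 := Finset.sum_eq_zero fun n hn => by
        by_contra hne
        have h1 := hN (show F n ≠ 0 from left_ne_zero_of_mul hne)
        exact (hx n hn).not_gt (h1.trans_lt (PNat.lt_add_right _ _))
      rw [this, abs_zero]
      exact mul_nonneg (by positivity) (Real.iSup_nonneg fun _ => abs_nonneg _)
    · obtain ⟨N, hN⟩ := h.bddAbove
      obtain ⟨N', hN'⟩ := ih hG
      refine ⟨max (N + 1) N', fun x hx => ?_⟩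
      have : evalAt x F = 1 / 2 * evalAt x G := by
        rw [evalAt, evalAt, Finset.mul_sum]
        refine Finset.sum_congr rfl fun n hn => ?_
        have : F n = 1 / 2 * G n := by
          by_contra hne
          have h1 := hN (show F n ≠ 1 / 2 * G n from hne)
          exact ((le_max_left _ _).trans (hx n hn)).not_gt (h1.trans_lt (PNat.lt_add_right _ _))
        rw [this, mul_assoc]
      rw [this, abs_mul, abs_of_pos (by norm_num : (0 : ℝ) < 1 / 2), pow_succ']
      have := hN' x fun n hn => (le_max_right _ _).trans (hx n hn)
      linarith

end Choices

/-! ### Convex combinations of small norm and the shrinking property. -/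

open MeasureTheory CompactlySupported in
/-- On a compact space, a convex set of continuous functions that contains a bounded sequence
converging pointwise to `0` contains functions that are uniformly small from above. -/
theorem exists_mem_forall_lt_of_tendsto_zero {K : Type*} [TopologicalSpace K] [CompactSpace K]
    [T2Space K] {C : Set C(K, ℝ)} (hC : Convex ℝ C) {h : ℕ → C(K, ℝ)} (hh : ∀ i, h i ∈ C)
    (hbd : ∀ i x, |h i x| ≤ 1) (hlim : ∀ x, Tendsto (fun i => h i x) atTop (𝓝 0)) {ε : ℝ}
    (hε : 0 < ε) : ∃ g ∈ C, ∀ x, g x < ε := by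
  by_contra! hcon
  let s : Set C(K, ℝ) := {g | ∀ x, g x < ε}
  have hs1 : Convex ℝ s := by
    intro g hg k hk a b ha hb hab x
    have h1 := hg x
    have h2 := hk x
    simp only [ContinuousMap.add_apply, ContinuousMap.smul_apply, smul_eq_mul]
    exact (convex_Iio ε) h1 h2 ha hb hab
  have hs2 : IsOpen s := by
    have := ContinuousMap.isOpen_setOfPred_mapsTo (X := K) isCompact_univ (isOpen_Iio (a := ε))
    convert this using 1
    ext g
    simp [s, Set.MapsTo]
  obtain ⟨φ, u, hφ1, hφ2⟩ := geometric_hahn_banach_open hs1 hs2 hC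
    (Set.disjoint_left.mpr fun g hg hgC => by
      obtain ⟨x, hx⟩ := hcon g hgC
      exact hx.not_gt (hg x))
  have hu : 0 < u := by simpa using hφ1 0 (fun x => by simpa using hε)
  -- Otherwise the nonpositive multiple `(u / φ g) • g` would lie in `s`, where `φ < u`, yet take
  -- the value `u`. Positivity lets `φ` be represented by a measure.
  have hpos : ∀ g : C(K, ℝ), 0 ≤ g → 0 ≤ φ g := by
    intro g hg
    by_contra! hneg
    have h1 := hφ1 ((u / φ g) • g) (fun x => by
      have h2 : u / φ g ≤ 0 := (div_neg_of_pos_of_neg hu hneg).le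
      exact lt_of_le_of_lt (mul_nonpos_of_nonpos_of_nonneg h2 (hg x)) hε)
    rw [map_smul, smul_eq_mul, div_mul_cancel₀ _ hneg.ne] at h1
    exact lt_irrefl _ h1
  let Λ : C_c(K, ℝ) →ₚ[ℝ] ℝ := PositiveLinearMap.mk₀
    { toFun := fun g => φ g.toContinuousMap
      map_add' := fun g k => φ.map_add g.toContinuousMap k.toContinuousMap
      map_smul' := fun c g => φ.map_smul c g.toContinuousMap } fun g hg => hpos _ hg
  let _ : MeasurableSpace K := borel K
  have _ : BorelSpace K := ⟨rfl⟩
  let μ := RealRMK.rieszMeasure Λ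
  have hint : ∀ i, ∫ x, h i x ∂μ = φ (h i) := fun i =>
    RealRMK.integral_rieszMeasure Λ (CompactlySupportedContinuousMap.continuousMapEquiv (h i))
  have hfin : IsFiniteMeasure μ := inferInstance
  have hten : Tendsto (fun i => ∫ x, h i x ∂μ) atTop (𝓝 (∫ _, (0 : ℝ) ∂μ)) :=
    tendsto_integral_of_dominated_convergence (fun _ => 1)
      (fun i => (h i).continuous.aestronglyMeasurable) (integrable_const _)
      (fun i => Eventually.of_forall fun x => hbd i x) (Eventually.of_forall hlim)
  rw [integral_zero] at hten
  obtain ⟨i, hi⟩ := (hten.eventually (gt_mem_nhds hu)).exists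
  rw [hint] at hi
  exact hi.not_ge (hφ2 _ (hh i))

namespace Choices

variable {D : Choices}

theorem evalAt_add (x y : ℕ+ →₀ ℝ) (F : ℕ+ → ℝ) : evalAt (x + y) F = evalAt x F + evalAt y F :=
  Finsupp.sum_add_index' (h := fun n c => F n * c) (by simp) fun _ _ _ => mul_add _ _ _

theorem evalAt_smul (c : ℝ) (x : ℕ+ →₀ ℝ) (F : ℕ+ → ℝ) : evalAt (c • x) F = c * evalAt x F := by
  refine (Finsupp.sum_smul_index (h := fun n c => F n * c) (by simp)).trans ?_
  rw [evalAt, Finset.mul_sum]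
  exact Finset.sum_congr rfl fun n _ => by ring

/-- A bounded sequence supported farther and farther out has convex combinations of small norm. -/
theorem exists_mem_convexHull_normW_le {x : ℕ → ℕ+ →₀ ℝ} (hx : ∀ i, D.normW (x i) ≤ 1)
    (hfar : ∀ N : ℕ+, ∀ᶠ i in atTop, ∀ n ∈ (x i).support, N ≤ n) {ε : ℝ} (hε : 0 < ε) :
    ∃ y ∈ convexHull ℝ (Set.range x), D.normW y ≤ ε := by
  have : CompactSpace D.closureW := isCompact_iff_compactSpace.mp D.isCompact_closureW
  -- Taking all majorants of `|evalAt y|` makes the set convex, and a one-sided bound on a majorant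
  -- controls the norm of `y`.
  let C : Set C(D.closureW, ℝ) :=
    {g | ∃ y ∈ convexHull ℝ (Set.range x), ∀ F : D.closureW, |evalAt y F| ≤ g F}
  have hC : Convex ℝ C := by
    rintro g ⟨y, hy, hg⟩ k ⟨z, hz, hk⟩ a b ha hb hab
    refine ⟨a • y + b • z, convex_convexHull ℝ _ hy hz ha hb hab, fun F => ?_⟩
    rw [evalAt_add, evalAt_smul, evalAt_smul]
    refine (abs_add_le _ _).trans ?_
    rw [abs_mul, abs_mul, abs_of_nonneg ha, abs_of_nonneg hb]
    exact add_le_add (mul_le_mul_of_nonneg_left (hg F) ha) (mul_le_mul_of_nonneg_left (hk F) hb)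
  obtain ⟨g, ⟨y, hy, hg⟩, hlt⟩ := exists_mem_forall_lt_of_tendsto_zero hC
    (h := fun i => ⟨fun F => |evalAt (x i) F|,
      ((continuous_evalAt (x i)).comp continuous_subtype_val).abs⟩)
    (fun i => ⟨x i, subset_convexHull ℝ _ ⟨i, rfl⟩, fun F => le_rfl⟩)
    (fun i F => by
      simpa using (abs_evalAt_le (x i) F.2).trans (hx i))
    (fun F => by
      refine Metric.tendsto_atTop.mpr fun δ hδ => ?_
      obtain ⟨k, hk⟩ := exists_pow_lt_of_lt_one hδ (by norm_num : (1 / 2 : ℝ) < 1)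
      obtain ⟨N, hN⟩ := exists_abs_evalAt_le k F.2
      obtain ⟨i₀, hi₀⟩ := eventually_atTop.mp (hfar N)
      refine ⟨i₀, fun i hi => ?_⟩
      have h1 := hN (x i) (hi₀ i hi)
      have h2 := mul_le_mul_of_nonneg_left (hx i) (by positivity : (0 : ℝ) ≤ (1 / 2) ^ k)
      simp only [ContinuousMap.coe_mk, dist_zero_right, Real.norm_eq_abs, abs_abs]
      linarith) hε
  refine ⟨y, hy, Real.iSup_le (fun f => ?_) hε.le⟩
  exact (hg ⟨_, coe_mem_closureW (Or.inr f.2)⟩).trans (hlt _).le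

/-- The unit vector basis is shrinking. -/
theorem exists_abs_le_of_support_ge {φ : (ℕ+ →₀ ℝ) →ₗ[ℝ] ℝ} {M : ℝ}
    (hφ : ∀ x, |φ x| ≤ M * D.normW x) {ε : ℝ} (hε : 0 < ε) :
    ∃ N : ℕ, ∀ x : ℕ+ →₀ ℝ, (∀ n ∈ x.support, N ≤ (n : ℕ)) → |φ x| ≤ ε * D.normW x := by
  by_contra! h
  choose x hx hlt using h
  have hnn : ∀ y, 0 ≤ D.normW y := fun y => Real.iSup_nonneg fun _ => abs_nonneg _
  have hpos : ∀ i, 0 < D.normW (x i) := fun i => by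
    refine (hnn _).lt_of_ne fun h0 => ?_
    have h1 := hlt i
    have h2 := hφ (x i)
    rw [← h0, mul_zero] at h1 h2
    exact h1.not_ge h2
  have hsmul : ∀ (c : ℝ) y, D.normW (c • y) = |c| * D.normW y := map_smul_eq_mul D.seminormW
  let c : ℕ → ℝ := fun i => (SignType.sign (φ (x i)) : ℝ) * (D.normW (x i))⁻¹
  have hc : ∀ i, D.normW (c i • x i) ≤ 1 := fun i => by
    rw [hsmul, abs_mul, abs_inv, abs_of_pos (hpos i), mul_assoc, inv_mul_cancel₀ (hpos i).ne',
      mul_one]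
    cases SignType.sign (φ (x i)) <;> simp
  have hcφ : ∀ i, ε ≤ φ (c i • x i) := fun i => by
    rw [map_smul, smul_eq_mul]
    have : c i * φ (x i) = |φ (x i)| / D.normW (x i) := by
      rw [← sign_mul_self (φ (x i))]
      simp only [c]
      ring
    rw [this, le_div_iff₀ (hpos i)]
    exact (hlt i).le
  have hM : 0 < |M| + 1 := by positivity
  obtain ⟨y, hy, hsmall⟩ := exists_mem_convexHull_normW_le (D := D) hc (fun N => by
    filter_upwards [eventually_ge_atTop (N : ℕ)] with i hi n hn
    have := hx i n (Finsupp.support_smul hn)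
    exact_mod_cast hi.trans this) (ε := ε / 2 / (|M| + 1)) (by positivity)
  have h1 : ε ≤ φ y := by
    have hconv : Convex ℝ {y | ε ≤ φ y} := convex_halfSpace_ge φ.isLinear ε
    refine convexHull_min ?_ hconv hy
    rintro _ ⟨i, rfl⟩
    exact hcφ i
  have h2 : |φ y| ≤ (|M| + 1) * (ε / 2 / (|M| + 1)) := by
    refine (hφ y).trans (mul_le_mul ?_ hsmall (hnn _) hM.le)
    linarith [le_abs_self M]
  rw [mul_div_cancel₀ _ hM.ne'] at h2
  linarith [le_abs_self (φ y)]

end Choices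

/-! ### Expansions in the space, its dual and its bidual. -/

namespace Choices

variable (D : Choices)

/-- The inclusion of `c₀₀` into the space. -/
def incl : (ℕ+ →₀ ℝ) →ₗ[ℝ] TEssInc D :=
  (UniformSpace.Completion.toComplL (𝕜 := ℝ) (E := C00 D)).toLinearMap

theorem norm_incl (x : ℕ+ →₀ ℝ) : ‖D.incl x‖ = D.normW x :=
  UniformSpace.Completion.norm_coe (E := C00 D) x

theorem denseRange_incl : DenseRange D.incl :=
  UniformSpace.Completion.denseRange_coe (α := C00 D)

variable {D}

theorem norm_le_of_forall_incl {Θ : TEssInc D →L[ℝ] ℝ} {c : ℝ} (hc : 0 ≤ c)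
    (h : ∀ x, |Θ (D.incl x)| ≤ c * D.normW x) : ‖Θ‖ ≤ c := by
  refine Θ.opNorm_le_bound hc fun z => ?_
  refine D.denseRange_incl.induction_on z (isClosed_le (by fun_prop) (by fun_prop)) fun x => ?_
  rw [norm_incl]
  exact h x

theorem ext_incl {Θ Θ' : TEssInc D →L[ℝ] ℝ} (h : ∀ x, Θ (D.incl x) = Θ' (D.incl x)) : Θ = Θ' := by
  ext z
  exact D.denseRange_incl.induction_on z (isClosed_eq (by fun_prop) (by fun_prop)) h

theorem exists_functional {f : ℕ+ →₀ ℝ} (hf : f = 0 ∨ f ∈ D.W) :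
    ∃ Θ : TEssInc D →L[ℝ] ℝ, ‖Θ‖ ≤ 1 ∧ ∀ x, Θ (D.incl x) = pairing f x := by
  let l : C00 D →L[ℝ] ℝ := LinearMap.mkContinuous
    { toFun := fun x => pairing f x
      map_add' := pairing_add f
      map_smul' := pairing_smul f } 1 fun x => by
        rw [one_mul]
        exact abs_pairing_le hf x
  let Θ := l.extend (UniformSpace.Completion.toComplL (𝕜 := ℝ) (E := C00 D))
  have hΘ : ∀ x, Θ (D.incl x) = pairing f x := fun x =>
    l.extend_eq (UniformSpace.Completion.denseRange_coe (α := C00 D))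
      (UniformSpace.Completion.isUniformInducing_coe (C00 D)) x
  refine ⟨Θ, norm_le_of_forall_incl zero_le_one fun x => ?_, hΘ⟩
  rw [hΘ, one_mul]
  exact abs_pairing_le hf x

theorem single_mem_W (n : ℕ+) : Finsupp.single n (1 : ℝ) ∈ D.W :=
  mem_W_iff.mpr ⟨∅, fun _ => 0, ⟨Set.empty_subset _, fun _ h => h.elim⟩, .unit n _ (Or.inl rfl) rfl⟩

variable (D) in
/-- The biorthogonal functionals of the unit vector basis. -/
def coord (n : ℕ+) : TEssInc D →L[ℝ] ℝ := (exists_functional (Or.inr (D.single_mem_W n))).choose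

theorem coord_incl (n : ℕ+) (x : ℕ+ →₀ ℝ) : D.coord n (D.incl x) = x n := by
  rw [coord, (exists_functional (Or.inr (D.single_mem_W n))).choose_spec.2, pairing]
  by_cases hn : x n = 0
  · rw [hn]
    refine Finset.sum_eq_zero fun i hi => ?_
    rw [Finsupp.single_apply, if_neg, zero_mul]
    rintro rfl
    exact Finsupp.mem_support_iff.mp hi hn
  · rw [Finset.sum_eq_single n]
    · simp
    · intro i _ hi
      rw [Finsupp.single_apply, if_neg hi.symm, zero_mul]
    · exact fun h => absurd (Finsupp.mem_support_iff.mpr hn) h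

open Classical in
theorem exists_restriction {f : ℕ+ →₀ ℝ} (hf : f ∈ D.W) (p : ℕ+ → Prop) :
    ∃ g : ℕ+ →₀ ℝ, (g = 0 ∨ g ∈ D.W) ∧ ∀ n, g n = if p n then f n else 0 :=
  ⟨_, mem_W_mulSign hf fun n => if p n then 1 else 0, fun n => by
    rw [mulSign_apply]; split_ifs <;> simp⟩

/-- Dually, restricting a functional in `W` to a set of coordinates gives `0` or an element of `W`.
-/
theorem normW_filter_le (x : ℕ+ →₀ ℝ) (p : ℕ+ → Prop) [DecidablePred p] :
    D.normW (x.filter p) ≤ D.normW x := by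
  refine Real.iSup_le (fun f => ?_) (Real.iSup_nonneg fun _ => abs_nonneg _)
  obtain ⟨g, hg, hgf⟩ := exists_restriction f.2 p
  refine le_trans (le_of_eq ?_) (abs_pairing_le hg x)
  rw [pairing_eq_sum f.1 (x.filter p) (s := x.support) (by
    rw [Finsupp.support_filter]; exact Finset.filter_subset _ _), pairing]
  congr 1
  refine Finset.sum_congr rfl fun n _ => ?_
  rw [hgf, Finsupp.filter_apply]
  by_cases hp : p n <;> simp [hp]

theorem sub_sum_coord_incl (φ : TEssInc D →L[ℝ] ℝ) (s : Finset ℕ+) (x : ℕ+ →₀ ℝ) :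
    (φ - ∑ n ∈ s, φ (D.incl (Finsupp.single n 1)) • D.coord n) (D.incl x) =
      φ (D.incl (x.filter (· ∉ s))) := by
  have hdec : x = ∑ n ∈ s, x n • Finsupp.single n (1 : ℝ) + x.filter (· ∉ s) := by
    ext k
    rw [Finsupp.add_apply, Finsupp.finsetSum_apply, Finsupp.filter_apply]
    simp only [Finsupp.smul_apply, Finsupp.single_apply, smul_eq_mul, mul_ite, mul_one, mul_zero,
      Finset.sum_ite_eq']
    by_cases hk : k ∈ s <;> simp [hk]
  have h1 : φ (D.incl x) = ∑ n ∈ s, x n * φ (D.incl (Finsupp.single n 1)) +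
      φ (D.incl (x.filter (· ∉ s))) := by
    conv_lhs => rw [hdec]
    rw [map_add, map_add, map_sum, map_sum]
    simp only [map_smul, smul_eq_mul]
  have h2 : (∑ n ∈ s, φ (D.incl (Finsupp.single n 1)) • D.coord n) (D.incl x) =
      ∑ n ∈ s, x n * φ (D.incl (Finsupp.single n 1)) := by
    rw [sum_apply]
    refine Finset.sum_congr rfl fun n _ => ?_
    rw [smul_apply, coord_incl, smul_eq_mul, mul_comm]
  rw [sub_apply, h1, h2, add_sub_cancel_left]

theorem exists_abs_apply_incl_le (φ : TEssInc D →L[ℝ] ℝ) {ε : ℝ} (hε : 0 < ε) :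
    ∃ N : ℕ, ∀ x : ℕ+ →₀ ℝ, (∀ n ∈ x.support, N ≤ (n : ℕ)) →
      |φ (D.incl x)| ≤ ε * D.normW x := by
  refine exists_abs_le_of_support_ge (φ := φ.toLinearMap ∘ₗ D.incl) (M := ‖φ‖) (fun x => ?_) hε
  rw [← norm_incl]
  exact φ.le_opNorm _

theorem norm_sub_sum_coord_le (φ : TEssInc D →L[ℝ] ℝ) {ε : ℝ} (hε : 0 < ε) :
    ∃ s₀ : Finset ℕ+, ∀ s, s₀ ⊆ s →
      ‖φ - ∑ n ∈ s, φ (D.incl (Finsupp.single n 1)) • D.coord n‖ ≤ ε := by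
  obtain ⟨N, hN⟩ := exists_abs_apply_incl_le φ hε
  refine ⟨Finset.Iic (Nat.succPNat N), fun s hs => norm_le_of_forall_incl hε.le fun x => ?_⟩
  rw [sub_sum_coord_incl]
  refine (hN _ fun n hn => ?_).trans (mul_le_mul_of_nonneg_left (normW_filter_le x _) hε.le)
  rw [Finsupp.support_filter, Finset.mem_filter] at hn
  by_contra! hlt
  refine hn.2 (hs (Finset.mem_Iic.mpr ?_))
  rw [← PNat.coe_le_coe, Nat.succPNat_coe]
  exact hlt.le.trans (Nat.le_succ N)

/-- The expansion of a functional along the biorthogonal functionals converges in norm. -/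
theorem hasSum_coord (φ : TEssInc D →L[ℝ] ℝ) :
    HasSum (fun n => φ (D.incl (Finsupp.single n 1)) • D.coord n) φ := by
  rw [HasSum, SummationFilter.unconditional_filter]
  refine Metric.tendsto_atTop.mpr fun ε hε => ?_
  obtain ⟨s₀, hs₀⟩ := norm_sub_sum_coord_le φ (half_pos hε)
  refine ⟨s₀, fun s hs => ?_⟩
  rw [dist_comm, dist_eq_norm]
  exact (hs₀ s hs).trans_lt (half_lt_self hε)

open Classical in
/-- The unit vector basis is boundedly complete. -/
theorem summable_of_bounded {a : ℕ+ → ℝ} {C : ℝ}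
    (h : ∀ s : Finset ℕ+, D.normW (∑ n ∈ s, Finsupp.single n (a n)) ≤ C) :
    Summable fun n => D.incl (Finsupp.single n (a n)) := by
  refine summable_iff_vanishing_norm.mpr ?_
  by_contra! hcon
  obtain ⟨ε, hε, hcon⟩ := hcon
  have hcon' : ∀ s : Finset ℕ+, ∃ t, Disjoint t s ∧
      ε ≤ D.normW (∑ n ∈ t, Finsupp.single n (a n)) := fun s => by
    obtain ⟨t, ht1, ht2⟩ := hcon s
    rw [← map_sum, norm_incl] at ht2
    exact ⟨t, ht1, ht2⟩
  obtain ⟨t, ht1, ht2⟩ := exists_seq_of_forall_finset_exists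
    (fun t : Finset ℕ+ => ε ≤ D.normW (∑ n ∈ t, Finsupp.single n (a n))) Before (by
      intro S _
      -- Avoiding every initial segment ending in an earlier block turns disjointness into lying
      -- beyond these blocks.
      obtain ⟨t, ht1, ht2⟩ := hcon' (S.biUnion fun s => s.biUnion fun n => Finset.Iic n)
      refine ⟨t, ht2, fun s hs x hx y hy => ?_⟩
      by_contra! hle
      exact Finset.disjoint_left.mp ht1 hy (Finset.mem_biUnion.mpr ⟨s, hs,
        Finset.mem_biUnion.mpr ⟨x, hx, Finset.mem_Iic.mpr hle⟩⟩))
  have hsupp : ∀ s : Finset ℕ+, (∑ n ∈ s, Finsupp.single n (a n)).support ⊆ s := fun s k hk => by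
    by_contra hks
    rw [Finsupp.mem_support_iff, Finsupp.finsetSum_apply] at hk
    refine hk (Finset.sum_eq_zero fun n hn => ?_)
    rw [Finsupp.single_apply, if_neg]
    rintro rfl
    exact hks hn
  obtain ⟨F, hF⟩ := exists_lt_normW_sum (D := D) (x := fun i => ∑ n ∈ t i, Finsupp.single n (a n))
    (fun i j hij x hx y hy => ht2 i j hij x (hsupp _ hx) y (hsupp _ hy)) (half_pos hε)
    (fun i => (half_lt_self hε).trans_le (ht1 i)) C
  rw [← Finset.sum_biUnion] at hF
  · exact hF.not_ge (h _)
  · intro i _ j _ hij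
    refine Finset.disjoint_left.mpr fun x hx hx' => ?_
    rcases lt_or_gt_of_ne hij with hlt | hlt
    · exact lt_irrefl _ (ht2 _ _ hlt x hx x hx')
    · exact lt_irrefl _ (ht2 _ _ hlt x hx' x hx)

/-- Testing against `f ∈ W` amounts to applying `ξ` to `f` restricted to `s`, which is a combination
of the `coord n` and has dual norm at most `1`. -/
theorem normW_sum_bidual_le (ξ : StrongDual ℝ (StrongDual ℝ (TEssInc D))) (s : Finset ℕ+) :
    D.normW (∑ n ∈ s, Finsupp.single n (ξ (D.coord n))) ≤ ‖ξ‖ := by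
  classical
  refine Real.iSup_le (fun f => ?_) (norm_nonneg ξ)
  obtain ⟨g, hg, hgf⟩ := exists_restriction f.2 (· ∈ s)
  obtain ⟨Θ, hΘ, hΘg⟩ := exists_functional hg
  have hΘs : Θ = ∑ n ∈ s, f.1 n • D.coord n := by
    refine ext_incl fun x => ?_
    rw [hΘg, sum_apply,
      pairing_eq_sum g x (s := x.support ∪ s) Finset.subset_union_left]
    rw [← Finset.sum_subset (Finset.subset_union_right (s₁ := x.support))]
    · refine Finset.sum_congr rfl fun n hn => ?_
      rw [hgf, if_pos hn, smul_apply, coord_incl, smul_eq_mul]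
    · intro n _ hn
      rw [hgf, if_neg hn, zero_mul]
  have hpair : pairing f.1 (∑ n ∈ s, Finsupp.single n (ξ (D.coord n))) = ξ Θ := by
    rw [hΘs, map_sum, pairing_sum]
    refine Finset.sum_congr rfl fun n _ => ?_
    rw [pairing_eq_sum _ _ (s := {n}) Finsupp.support_single_subset, Finset.sum_singleton,
      Finsupp.single_eq_same, map_smul, smul_eq_mul]
  rw [hpair]
  exact (ξ.le_opNorm Θ).trans (mul_le_of_le_one_right (norm_nonneg ξ) hΘ)

end Choices

end EssInc

end

theorem mainTheorem10 (D : EssInc.Choices) : EssInc.IsReflexiveSpace (EssInc.TEssInc D) := by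
  intro ξ
  obtain ⟨z, hz⟩ := EssInc.Choices.summable_of_bounded (EssInc.Choices.normW_sum_bidual_le ξ)
  refine ⟨z, ContinuousLinearMap.ext fun φ => ?_⟩
  rw [NormedSpace.dual_def]
  refine (hz.mapL φ).unique ?_
  convert (EssInc.Choices.hasSum_coord φ).mapL ξ using 2 with n
  rw [map_smul, smul_eq_mul, mul_comm, ← smul_eq_mul, ← map_smul, ← map_smul, Finsupp.smul_single,
    smul_eq_mul, mul_one]
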